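/- All manifolds and tensor fields are smooth; manifolds are non-empty, Hausdorff and second countable. The exterior derivative is normalized by $d\eta(X,Y)=X(\eta(Y))-Y(\eta(X))-\eta([X,Y])$. **Definitions.** An *almost contact metric structure* $(\phi,\xi,\eta,g)$ on $M$ consists of a field of endomorphisms $\phi$ of $TM$, a vector field $\xi$, a $1$-form $\eta$ and a Riemannian metric $g$ with $\phi^2=-I+\eta\otimes\xi$, $\eta(\xi)=1$ and $g(\phi X,\phi Y)=g(X,Y)-\eta(X)\eta(Y)$; its fundamental $2$-form is $\Omega(X,Y)=g(X,\phi Y)$. It is *quasi-Sasakian* if $d\Omega=0$ and it is normal, i.e. $$[\phi X,\phi Y]-\phi[\phi X,Y]-\phi[X,\phi Y]+\phi^2[X,Y]+d\eta(X,Y)\,\xi=0$$ for all vector fields $X,Y$. The *rank* (Cartan class) of a $1$-form $\eta$ at $x$ is the codimension in $T_xM$ of its characteristic space $\mathcal C(\eta)_x=\{X\in T_xM : i_X\eta=0,\ i_Xd\eta=0\}$; $\eta$ has rank $k$ if this equals $k$ at every point. A *$3$-quasi-Sasakian manifold* $(M,\phi_\alpha,\xi_\alpha,\eta_\alpha,g)_{\alpha\in\{1,2,3\}}$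 is a manifold with three quasi-Sasakian structures with the same metric $g$ such that, for every even permutation $(\alpha,\beta,\gamma)$ of $\{1,2,3\}$, $$\phi_\gamma=\phi_\alpha\phi_\beta-\eta_\beta\otimes\xi_\alpha=-\phi_\beta\phi_\alpha+\eta_\alpha\otimes\xi_\beta,\quad \xi_\gamma=\phi_\alpha\xi_\beta=-\phi_\beta\xi_\alpha,\quad \eta_\gamma=\eta_\alpha\circ\phi_\beta=-\eta_\beta\circ\phi_\alpha.$$ It has *rank* $k$ if $\eta_1,\eta_2,\eta_3$ all have rank $k$. An *almost cosymplectic structure* on a manifold of dimension $2n+1$ is a pair $(\eta,\Omega)$ of a $1$-form and a $2$-form such that $\eta\wedge\Omega^n$ vanishes nowhere. Pairs $(\eta_i,\Omega_i)$, $i=1,2,3$, generate an *almost cosymplectic sphere* if each of them and each pair $(\eta_\lambda,\Omega_\lambda)=(\sum_i\lambda_i\eta_i,\sum_i\lambda_i\Omega_i)$ with $\lambda\in\mathbb S^2$ is an almost cosymplectic structure; the sphere is *quasi-contact of rank* $k>0$ if moreover $d\Omega_\lambda=0$ and $\eta_\lambda$ has rank $k$ for every $\lambda\in\mathbb S^2$.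 **Theorem.** Let $(M,\phi_\alpha,\xi_\alpha,\eta_\alpha,g)_{\alpha\in\{1,2,3\}}$ be a $3$-quasi-Sasakian manifold of rank $4l+3$, $l\ge 0$, with fundamental $2$-forms $\Omega_\alpha=g(\cdot,\phi_\alpha\cdot)$. For $\lambda\in\mathbb S^2$ put $$\phi_\lambda=\sum_\alpha\lambda_\alpha\phi_\alpha,\qquad \xi_\lambda=\sum_\alpha\lambda_\alpha\xi_\alpha,\qquad \eta_\lambda=\sum_\alpha\lambda_\alpha\eta_\alpha.$$ Then for every $\lambda\in\mathbb S^2$ the structure $(\phi_\lambda,\xi_\lambda,\eta_\lambda,g)$ is quasi-Sasakian, $\eta_\lambda$ has rank $4l+3$, and at every point the characteristic space $\mathcal C(\eta_\lambda)$ equals $\mathcal E=\{X : i_X\eta_\alpha=0,\ i_Xd\eta_\alpha=0 \text{ for } \alpha=1,2,3\}$. Moreover $(\eta_1,\Omega_1),(\eta_2,\Omega_2),(\eta_3,\Omega_3)$ generate an almost cosymplectic sphere, and this sphere is quasi-contact of rank $4l+3$. -/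

import Mathlib

open Set Bundle Manifold VectorField
open scoped Manifold ContDiff Topology

noncomputable section

namespace QuasiContact

/-! ### Multilinear algebra: exterior products and powers -/

section Wedge

variable {V : Type*} [AddCommGroup V] [Module ℝ V]

/-- The exterior product `a ∧ b` of two alternating forms: the signed sum of `a ⊗ b` over shuffles. -/
def wedge {p q : ℕ} (a : V [⋀^Fin p]→ₗ[ℝ] ℝ) (b : V [⋀^Fin q]→ₗ[ℝ] ℝ) :
    V [⋀^Fin (p + q)]→ₗ[ℝ] ℝ :=
  ((LinearMap.mul' ℝ ℝ).compAlternatingMap (a.domCoprod b)).domDomCongr finSumFinEquiv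

/-- The `n`-th exterior power `θ ∧ ⋯ ∧ θ` of an alternating 2-form. -/
def wedgePow (θ : V [⋀^Fin 2]→ₗ[ℝ] ℝ) : (n : ℕ) → V [⋀^Fin (2 * n)]→ₗ[ℝ] ℝ
  | 0 => haveI : IsEmpty (Fin (2 * 0)) := inferInstanceAs (IsEmpty (Fin 0))
    AlternatingMap.constOfIsEmpty ℝ V (Fin (2 * 0)) 1
  | n + 1 => wedge (wedgePow θ n) θ

end Wedge

section TwoForm

variable {E : Type*} [NormedAddCommGroup E] [NormedSpace ℝ E]

/-- The alternating 2-form `(v, w) ↦ B v w` given by a continuous bilinear form with `B v v = 0`. -/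
def twoForm (B : E →L[ℝ] E →L[ℝ] ℝ) (hB : ∀ v, B v v = 0) : E [⋀^Fin 2]→L[ℝ] ℝ where
  toFun v := B (v 0) (v 1)
  map_update_add' v i a b := by
    fin_cases i <;> simp [Function.update]
  map_update_smul' v i c a := by
    fin_cases i <;> simp [Function.update]
  map_eq_zero_of_eq' v i j hij hne := by
    have h01 : v 0 = v 1 := by
      fin_cases i <;> fin_cases j <;> simp_all
    simp [h01, hB]
  cont := by
    change Continuous fun v : Fin 2 → E => B (v 0) (v 1)
    fun_prop

end TwoForm

section Manifold

variable {E : Type*} [NormedAddCommGroup E] [NormedSpace ℝ E]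
  {M : Type*} [TopologicalSpace M] [ChartedSpace E M]

/-! ### Tensor fields on a manifold `M` modelled on `E` -/

variable (E M) in
/-- (Not necessarily smooth) vector fields. -/
abbrev VField := (x : M) → TangentSpace 𝓘(ℝ, E) x

variable (E M) in
/-- (Not necessarily smooth) fields of endomorphisms of the tangent spaces. -/
abbrev EndField := (x : M) → TangentSpace 𝓘(ℝ, E) x →L[ℝ] TangentSpace 𝓘(ℝ, E) x

variable (E M) in
/-- (Not necessarily smooth) 1-forms. -/
abbrev OneForm := (x : M) → TangentSpace 𝓘(ℝ, E) x →L[ℝ] ℝ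

variable (E M) in
/-- (Not necessarily smooth) differential `k`-forms. -/
abbrev DForm (k : ℕ) := (x : M) → TangentSpace 𝓘(ℝ, E) x [⋀^Fin k]→L[ℝ] ℝ

/-- A 1-form viewed as a differential form of degree 1. -/
def OneForm.toDForm (η : OneForm E M) : DForm E M 1 :=
  fun x => ContinuousAlternatingMap.ofSubsingleton ℝ (TangentSpace 𝓘(ℝ, E) x) ℝ (0 : Fin 1) (η x)

/-- The pull-back of a form to the model space by the inverse of the preferred chart at `x₀`. -/
def DForm.inChart {k : ℕ} (θ : DForm E M k) (x₀ : M) : E → E [⋀^Fin k]→L[ℝ] ℝ :=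
  fun y => (θ ((extChartAt 𝓘(ℝ, E) x₀).symm y)).compContinuousLinearMap
    (mfderiv 𝓘(ℝ, E) 𝓘(ℝ, E) (extChartAt 𝓘(ℝ, E) x₀).symm y)

/-- A form is smooth if it is smooth in the charts. -/
def DForm.IsSmooth {k : ℕ} (θ : DForm E M k) : Prop :=
  ∀ x₀ : M, ContDiffOn ℝ ∞ (θ.inChart x₀) (extChartAt 𝓘(ℝ, E) x₀).target

/-- The exterior derivative, computed in the preferred chart at each point. It is normalized so that
`dη(X, Y) = X(η(Y)) - Y(η(X)) - η([X, Y])` for 1-forms. -/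
def DForm.d {k : ℕ} (θ : DForm E M k) : DForm E M (k + 1) :=
  fun x => (extDeriv (θ.inChart x) (extChartAt 𝓘(ℝ, E) x x)).compContinuousLinearMap
    (mfderiv 𝓘(ℝ, E) 𝓘(ℝ, E) (extChartAt 𝓘(ℝ, E) x) x)

/-- The form is closed. -/
def DForm.IsClosed {k : ℕ} (θ : DForm E M k) : Prop := ∀ x, θ.d x = 0

/-! ### Characteristic distribution and rank (Cartan class) of a 1-form -/

/-- The characteristic distribution `{X | i_X η = 0, i_X dη = 0}` of a 1-form. -/
def charDist (η : OneForm E M) (x : M) : Submodule ℝ (TangentSpace 𝓘(ℝ, E) x) where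
  carrier := {v | η x v = 0 ∧ ∀ w : TangentSpace 𝓘(ℝ, E) x, η.toDForm.d x ![v, w] = 0}
  zero_mem' := ⟨map_zero _, fun w =>
    (η.toDForm.d x).toMultilinearMap.map_coord_zero (m := ![0, w]) 0 rfl⟩
  add_mem' {a b} ha hb := ⟨by rw [map_add, ha.1, hb.1, add_zero], fun w => by
    have h := (η.toDForm.d x).toMultilinearMap.cons_add ![w] a b
    have ha' := ha.2 w
    have hb' := hb.2 w
    exact h.trans (by
      change η.toDForm.d x ![a, w] + η.toDForm.d x ![b, w] = 0
      rw [ha', hb', add_zero])⟩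
  smul_mem' c a ha := ⟨by rw [map_smul, ha.1, smul_zero], fun w => by
    have h := (η.toDForm.d x).toMultilinearMap.cons_smul ![w] c a
    have ha' := ha.2 w
    exact h.trans (by
      change c • η.toDForm.d x ![a, w] = 0
      rw [ha', smul_zero])⟩

/-- The Cartan class of a 1-form at a point: the codimension of its characteristic space. -/
def cartanClass (η : OneForm E M) (x : M) : ℕ :=
  Module.finrank ℝ (TangentSpace 𝓘(ℝ, E) x ⧸ charDist η x)

/-- The 1-form has constant rank `k`, i.e. Cartan class `k` at every point. -/
def HasRank (η : OneForm E M) (k : ℕ) : Prop := ∀ x, cartanClass η x = k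

/-! ### Linear combinations -/

/-- `∑ lam_α T_α`, for a family of tensor fields `T_α` of one kind. -/
def combo {N : ℕ} {F : M → Type*} [∀ x, AddCommMonoid (F x)] [∀ x, Module ℝ (F x)]
    (lam : EuclideanSpace ℝ (Fin N)) (T : Fin N → (x : M) → F x) : (x : M) → F x :=
  fun x => ∑ α, lam α • T α x

/-! ### Almost cosymplectic and quasi-contact spheres -/

/-- `(η, Ω)` is an almost cosymplectic structure: a smooth 1-form and a smooth 2-form on a manifold
of dimension `2n + 1` with `η ∧ Ωⁿ` nowhere zero. -/
def IsAlmostCosymplectic (η : OneForm E M) (Ω : DForm E M 2) : Prop :=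
  η.toDForm.IsSmooth ∧ Ω.IsSmooth ∧ ∃ n : ℕ, Module.finrank ℝ E = 2 * n + 1 ∧
    ∀ x, wedge (η.toDForm x).toAlternatingMap (wedgePow (Ω x).toAlternatingMap n) ≠ 0

/-- The pairs `(η_i, Ω_i)`, `i = 1, …, p + 1`, generate an almost cosymplectic `p`-sphere. -/
structure IsAlmostCosymplecticSphere {p : ℕ} (η : Fin (p + 1) → OneForm E M)
    (Ω : Fin (p + 1) → DForm E M 2) : Prop where
  generators : ∀ i, IsAlmostCosymplectic (η i) (Ω i)
  combos : ∀ lam ∈ Metric.sphere (0 : EuclideanSpace ℝ (Fin (p + 1))) 1,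
    IsAlmostCosymplectic (combo lam η) (combo lam Ω)

/-- The almost cosymplectic `p`-sphere generated by the `(η_i, Ω_i)` is quasi-contact of rank `k`. -/
structure IsQuasiContactSphere {p : ℕ} (η : Fin (p + 1) → OneForm E M)
    (Ω : Fin (p + 1) → DForm E M 2) (k : ℕ) : Prop extends IsAlmostCosymplecticSphere η Ω where
  closed : ∀ lam ∈ Metric.sphere (0 : EuclideanSpace ℝ (Fin (p + 1))) 1,
    DForm.IsClosed (combo lam Ω)
  rank_pos : 0 < k
  rank : ∀ lam ∈ Metric.sphere (0 : EuclideanSpace ℝ (Fin (p + 1))) 1,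
    HasRank (combo lam η) k

/-! ### Almost contact metric structures -/

variable [IsManifold 𝓘(ℝ, E) ∞ M]

/-- Smooth vector fields. -/
def VField.IsSmooth (X : VField E M) : Prop :=
  ContMDiff 𝓘(ℝ, E) (𝓘(ℝ, E).prod 𝓘(ℝ, E)) ∞
    (fun x => (TotalSpace.mk' E x (X x) : TangentBundle 𝓘(ℝ, E) M))

/-- Smooth fields of endomorphisms, i.e. smooth sections of `Hom(TM, TM)`. -/
def EndField.IsSmooth (φ : EndField E M) : Prop :=
  ContMDiff 𝓘(ℝ, E) (𝓘(ℝ, E).prod 𝓘(ℝ, E →L[ℝ] E)) ∞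
    (fun x => TotalSpace.mk' (E →L[ℝ] E)
      (E := fun x : M => TangentSpace 𝓘(ℝ, E) x →L[ℝ] TangentSpace 𝓘(ℝ, E) x) x (φ x))

variable (E M) in
/-- Smooth Riemannian metrics. -/
abbrev RMetric := ContMDiffRiemannianMetric 𝓘(ℝ, E) ∞ E (fun x : M => TangentSpace 𝓘(ℝ, E) x)

/-- Almost contact structures: `φ² = -I + η ⊗ ξ` and `η(ξ) = 1`. -/
structure IsAlmostContact (φ : EndField E M) (ξ : VField E M) (η : OneForm E M) : Prop where
  smooth_φ : φ.IsSmooth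
  smooth_ξ : ξ.IsSmooth
  smooth_η : η.toDForm.IsSmooth
  φ_sq : ∀ x v, φ x (φ x v) = -v + η x v • ξ x
  η_ξ : ∀ x, η x (ξ x) = 1

/-- Almost contact metric structures: `g(φX, φY) = g(X, Y) - η(X) η(Y)`. -/
structure IsAlmostContactMetric (φ : EndField E M) (ξ : VField E M) (η : OneForm E M)
    (g : RMetric E M) : Prop extends IsAlmostContact φ ξ η where
  compatible : ∀ x v w, g.inner x (φ x v) (φ x w) = g.inner x v w - η x v * η x w

/-- For an almost contact metric structure, `g(X, φY)` is an alternating form. -/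
theorem IsAlmostContactMetric.inner_φ_self {φ : EndField E M} {ξ : VField E M} {η : OneForm E M}
    {g : RMetric E M} (h : IsAlmostContactMetric φ ξ η g) (x : M) (v : TangentSpace 𝓘(ℝ, E) x) :
    g.inner x v (φ x v) = 0 := by
  have hξ0 : ξ x ≠ 0 := fun h0 => by
    have h1 := h.η_ξ x
    rw [h0, map_zero] at h1
    exact zero_ne_one h1
  have hφφξ : φ x (φ x (ξ x)) = 0 := by rw [h.φ_sq, h.η_ξ, one_smul, neg_add_cancel]
  have h1 : φ x (ξ x) = η x (φ x (ξ x)) • ξ x := by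
    have h2 := h.φ_sq x (φ x (ξ x))
    rw [hφφξ, map_zero] at h2
    exact (neg_add_eq_zero.mp h2.symm)
  have h3 : η x (φ x (ξ x)) = 0 := by
    have h4 : η x (φ x (ξ x)) • (η x (φ x (ξ x)) • ξ x) = 0 := by
      rw [← h1, ← map_smul, ← h1, hφφξ]
    rcases smul_eq_zero.mp h4 with h5 | h5
    · exact h5
    · exact (smul_eq_zero.mp h5).resolve_right hξ0
  have hφξ : φ x (ξ x) = 0 := by rw [h1, h3, zero_smul]
  have hηφ : η x (φ x v) = 0 := by
    have h6 := h.φ_sq x (φ x v)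
    rw [h.φ_sq x v, map_add, map_neg, map_smul, hφξ, smul_zero, add_zero] at h6
    exact (smul_eq_zero.mp (left_eq_add.mp h6)).resolve_right hξ0
  have hgξ : g.inner x (φ x v) (ξ x) = 0 := by
    have h7 := h.compatible x (φ x v) (ξ x)
    rw [hφξ, map_zero, hηφ, zero_mul, sub_zero] at h7
    exact h7.symm
  have h8 := h.compatible x v (φ x v)
  rw [hηφ, mul_zero, sub_zero, h.φ_sq, map_add, map_neg, map_smul, hgξ, smul_zero, add_zero,
    g.symm x (φ x v) v] at h8
  linarith

/-- The fundamental 2-form `Ω(X, Y) = g(X, φY)`. -/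
def IsAlmostContactMetric.fundamentalForm {φ : EndField E M} {ξ : VField E M} {η : OneForm E M}
    {g : RMetric E M} (h : IsAlmostContactMetric φ ξ η g) : DForm E M 2 :=
  fun x => twoForm (E := E) ((ContinuousLinearMap.compL ℝ E E ℝ).flip (φ x) ∘L g.inner x)
    (h.inner_φ_self x)

theorem IsAlmostContactMetric.fundamentalForm_apply {φ : EndField E M} {ξ : VField E M}
    {η : OneForm E M} {g : RMetric E M} (h : IsAlmostContactMetric φ ξ η g) (x : M)
    (v w : TangentSpace 𝓘(ℝ, E) x) : h.fundamentalForm x ![v, w] = g.inner x v (φ x w) := rfl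

/-- Normality: the Nijenhuis torsion of `φ` satisfies `[φ, φ] + dη ⊗ ξ = 0`, i.e. the almost complex
structure `J(X, f ∂ₜ) = (φX - f ξ, η(X) ∂ₜ)` on `M × ℝ` is integrable. The coefficient of `dη` is `1`
with the present normalization of `d`, and `2` if `d` on 1-forms carries a factor `1/2`. -/
def IsNormal (φ : EndField E M) (ξ : VField E M) (η : OneForm E M) : Prop :=
  ∀ X Y : VField E M, X.IsSmooth → Y.IsSmooth → ∀ x : M,
    mlieBracket 𝓘(ℝ, E) (fun y => φ y (X y)) (fun y => φ y (Y y)) x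
      - φ x (mlieBracket 𝓘(ℝ, E) (fun y => φ y (X y)) Y x)
      - φ x (mlieBracket 𝓘(ℝ, E) X (fun y => φ y (Y y)) x)
      + φ x (φ x (mlieBracket 𝓘(ℝ, E) X Y x))
      + η.toDForm.d x ![X x, Y x] • ξ x = 0

/-- Quasi-Sasakian structures: normal almost contact metric structures with closed fundamental
2-form. -/
structure IsQuasiSasakian (φ : EndField E M) (ξ : VField E M) (η : OneForm E M)
    (g : RMetric E M) : Prop extends IsAlmostContactMetric φ ξ η g where
  normal : IsNormal φ ξ η
  closed : toIsAlmostContactMetric.fundamentalForm.IsClosed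

/-! ### 3-structures -/

/-- The relations of an almost contact 3-structure. The even permutations `(α, β, γ)` of the three
indices are the triples `(α, α + 1, α + 2)` modulo 3. -/
structure ThreeStructureRelations (φ : Fin 3 → EndField E M) (ξ : Fin 3 → VField E M)
    (η : Fin 3 → OneForm E M) : Prop where
  φ_left : ∀ (α : Fin 3) (x : M) (v : TangentSpace 𝓘(ℝ, E) x),
    φ (α + 2) x v = φ α x (φ (α + 1) x v) - η (α + 1) x v • ξ α x
  φ_right : ∀ (α : Fin 3) (x : M) (v : TangentSpace 𝓘(ℝ, E) x),
    φ (α + 2) x v = -φ (α + 1) x (φ α x v) + η α x v • ξ (α + 1) x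
  ξ_left : ∀ (α : Fin 3) (x : M), ξ (α + 2) x = φ α x (ξ (α + 1) x)
  ξ_right : ∀ (α : Fin 3) (x : M), ξ (α + 2) x = -φ (α + 1) x (ξ α x)
  η_left : ∀ (α : Fin 3) (x : M) (v : TangentSpace 𝓘(ℝ, E) x),
    η (α + 2) x v = η α x (φ (α + 1) x v)
  η_right : ∀ (α : Fin 3) (x : M) (v : TangentSpace 𝓘(ℝ, E) x),
    η (α + 2) x v = -η (α + 1) x (φ α x v)

/-- 3-quasi-Sasakian structures: almost contact metric 3-structures all of whose three members are
quasi-Sasakian. -/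
structure IsThreeQuasiSasakian (φ : Fin 3 → EndField E M) (ξ : Fin 3 → VField E M)
    (η : Fin 3 → OneForm E M) (g : RMetric E M) : Prop
    extends ThreeStructureRelations φ ξ η where
  quasiSasakian : ∀ α, IsQuasiSasakian (φ α) (ξ α) (η α) g

/-- A 3-quasi-Sasakian manifold has rank `k` if `η₁, η₂, η₃` have the same constant rank `k`. -/
structure IsThreeQuasiSasakianOfRank (φ : Fin 3 → EndField E M) (ξ : Fin 3 → VField E M)
    (η : Fin 3 → OneForm E M) (g : RMetric E M) (k : ℕ) : Prop
    extends IsThreeQuasiSasakian φ ξ η g where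
  rank : ∀ α, HasRank (η α) k

/-- The fundamental 2-forms `Ω_α = g(·, φ_α ·)` of a 3-quasi-Sasakian structure. -/
def IsThreeQuasiSasakian.Ω {φ : Fin 3 → EndField E M} {ξ : Fin 3 → VField E M}
    {η : Fin 3 → OneForm E M} {g : RMetric E M} (h : IsThreeQuasiSasakian φ ξ η g) :
    Fin 3 → DForm E M 2 :=
  fun α => (h.quasiSasakian α).fundamentalForm

/-- The distribution `{X | i_X η_α = 0, i_X dη_α = 0 for α = 1, 2, 3}`. -/
def commonCharDist (η : Fin 3 → OneForm E M) (x : M) : Submodule ℝ (TangentSpace 𝓘(ℝ, E) x) :=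
  ⨅ α, charDist (η α) x

end Manifold

end QuasiContact

end

noncomputable section

namespace QuasiContact

/-!
Let `∇` be the Levi-Civita connection. For a quasi-Sasakian structure, closedness of `Ω` and
normality together say that `∇ξ` is skew and commutes with `φ`, and that
`(∇_u φ) v = g(φ ∇_u ξ, v) ξ - η(v) φ ∇_u ξ`. For a 3-structure, differentiating `ξ_γ = φ_α ξ_β`
shows that the three operators `-φ_α ∇ξ_α`, each corrected by a common multiple of `η_α ⊗ ξ_α`,
are one and the same symmetric operator `A`, which commutes with every `φ_α` and satisfies
`∇_u ξ_α = φ_α A u` and `(∇_u φ_α) v = η_α(v) A u - g(A u, v) ξ_α`. These equations are linear in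
the structure, so they pass to the combinations with coefficients `λ`; conversely they imply
normality and `dΩ = 0`.

There is `a` with `A ξ_λ = a ξ_λ` for every `λ`, and `C(η_λ) = ker η_λ ∩ ker A`. If `a = 0`, the
range of `A` is orthogonal to all `ξ_α` and is quaternionic, so the rank is congruent to `1` modulo
`4`. Rank `4l + 3` therefore forces `a ≠ 0`, hence `C(η_λ) = ker A` independently of `λ`. Finally
`η ∧ Ωⁿ ≠ 0` is read off on a frame adapted to `φ`.
-/

section ContactMetric

variable {V : Type*} [AddCommGroup V] [Module ℝ V] [TopologicalSpace V]

/-- An almost contact metric structure `(φ, ξ, g(ξ, ·), g)` on a single vector space. -/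
structure IsLinearContactMetric (g : V →L[ℝ] V →L[ℝ] ℝ) (φ : V →L[ℝ] V) (ξ : V) : Prop where
  symm : ∀ u v, g u v = g v u
  pos : ∀ v, v ≠ 0 → 0 < g v v
  sq : ∀ v, φ (φ v) = -v + g ξ v • ξ
  map_ξ : φ ξ = 0
  skew : ∀ u v, g (φ u) v = -g u (φ v)
  unit : g ξ ξ = 1

namespace IsLinearContactMetric

variable {g : V →L[ℝ] V →L[ℝ] ℝ} {φ : V →L[ℝ] V} {ξ : V} (h : IsLinearContactMetric g φ ξ)

include h

theorem ext {u v : V} (huv : ∀ w, g u w = g v w) : u = v := by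
  by_contra hne
  have hpos := h.pos (u - v) (sub_ne_zero.2 hne)
  rw [map_sub g u v, sub_apply, huv, sub_self] at hpos
  exact hpos.false

theorem inner_ξ_map (v : V) : g ξ (φ v) = 0 := by
  rw [← neg_eq_zero, ← h.skew, h.map_ξ, map_zero, zero_apply]

theorem inner_map_ξ (v : V) : g (φ v) ξ = 0 := by
  rw [h.symm, h.inner_ξ_map]

theorem inner_map_map (u v : V) : g (φ u) (φ v) = g u v - g ξ u * g ξ v := by
  rw [h.skew, h.sq, map_add, map_neg, map_smul, smul_eq_mul, h.symm u ξ]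
  ring

theorem map_ξ_eq_of_comm {A : V →L[ℝ] V} (comm : ∀ u, φ (A u) = A (φ u)) :
    A ξ = g ξ (A ξ) • ξ := by
  have hsq := h.sq (A ξ)
  rw [comm, h.map_ξ, map_zero, map_zero] at hsq
  exact neg_add_eq_zero.1 hsq.symm

end IsLinearContactMetric

theorem inner_eq_zero_of_map_eq_zero {g : V →L[ℝ] V →L[ℝ] ℝ} {A : V →L[ℝ] V} {ξ : V}
    (symm : ∀ u v, g (A u) v = g u (A v)) {a : ℝ} (ha : A ξ = a • ξ) (ha0 : a ≠ 0) {v : V}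
    (hv : A v = 0) : g ξ v = 0 := by
  have hs := symm ξ v
  rw [ha, hv, map_smul, map_zero, smul_apply, smul_eq_mul] at hs
  exact (mul_eq_zero.1 hs).resolve_left ha0

end ContactMetric

section Jet

variable {V : Type*} [AddCommGroup V] [Module ℝ V] [TopologicalSpace V] [IsTopologicalAddGroup V]
  [ContinuousSMul ℝ V]

/-- The identities satisfied at a point by `P = ∇φ` and `B = ∇ξ`, for a torsion-free metric
connection `∇` and a quasi-Sasakian structure `(φ, ξ, g(ξ, ·), g)`. -/
structure IsQuasiSasakianJet (g : V →L[ℝ] V →L[ℝ] ℝ) (φ : V →L[ℝ] V) (ξ : V)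
    (P : V →L[ℝ] V →L[ℝ] V) (B : V →L[ℝ] V) : Prop extends IsLinearContactMetric g φ ξ where
  deriv_sq : ∀ u v, P u (φ v) + φ (P u v) = g (B u) v • ξ + g ξ v • B u
  deriv_skew : ∀ u v w, g (P u v) w = -g v (P u w)
  deriv_map_ξ : ∀ u, P u ξ = -φ (B u)
  deriv_unit : ∀ u, g ξ (B u) = 0
  normal : ∀ u v, P (φ u) v - P (φ v) u + φ (P v u) - φ (P u v) + (g (B u) v - g (B v) u) • ξ = 0
  closed : ∀ u v w, g v (P u w) - g u (P v w) + g u (P w v) = 0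

/-- A structure operator for `P = ∇φ` and `B = ∇ξ` at a point: a symmetric operator `A` commuting
with `φ` that determines these derivatives by `∇ξ = φA` and
`(∇_u φ) v = g(ξ, v) A u - g(A u, v) ξ`. For a Sasakian structure `A = ± id`. -/
structure IsStructureOperator (g : V →L[ℝ] V →L[ℝ] ℝ) (φ : V →L[ℝ] V) (ξ : V)
    (P : V →L[ℝ] V →L[ℝ] V) (B A : V →L[ℝ] V) : Prop where
  symm : ∀ u v, g (A u) v = g u (A v)
  comm : ∀ u, φ (A u) = A (φ u)
  deriv_ξ : ∀ u, B u = φ (A u)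
  deriv_φ : ∀ u v, P u v = g ξ v • A u - g (A u) v • ξ

/-- A tensor of the type of `∇φ` vanishes when its parts seen by `dΩ` and by the Nijenhuis torsion
do, just as `∇J = 0` for an integrable `J` with closed Kähler form. -/
theorem eq_zero_of_cyclic_of_normal {W : Type*} {f : W → W} {q : W → W → W → ℝ}
    (skew : ∀ u v w, q u v w = -q u w v)
    (map_left : ∀ u v w, q u (f v) w = q u v (f w))
    (map_map : ∀ u v w, q u (f v) (f w) = -q u v w)
    (cyclic : ∀ u v w, q u v w + q v w u + q w u v = 0)
    (normal : ∀ u v w, q (f u) v w - q (f v) u w - q v u (f w) + q u v (f w) = 0) (u v w : W) :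
    q u v w = 0 := by
  have map_map_right : ∀ a b c, q a b (f (f c)) = -q a b c := fun a b c => by
    rw [← map_left, map_map]
  have hnormal := normal v w (f u)
  rw [map_map_right, map_map_right, ← map_left, ← map_left, skew (f w) (f v) u] at hnormal
  linarith [cyclic u (f v) (f w), cyclic u v w, map_map u v w, skew w v u]

namespace IsQuasiSasakianJet

variable {g : V →L[ℝ] V →L[ℝ] ℝ} {φ : V →L[ℝ] V} {ξ : V} {P : V →L[ℝ] V →L[ℝ] V}
  {B : V →L[ℝ] V} (h : IsQuasiSasakianJet g φ ξ P B)

include h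

theorem normal_inner (u v w : V) : g (P (φ u) v) w - g (P (φ v) u) w - g (P v u) (φ w)
    + g (P u v) (φ w) + (g (B u) v - g (B v) u) * g ξ w = 0 := by
  have hn := congrArg (fun z => g z w) (h.normal u v)
  simp only [map_add, map_sub, map_smul, add_apply, map_zero, sub_apply, smul_apply, smul_eq_mul,
    zero_apply, h.skew] at hn
  linarith

theorem B_ξ : B ξ = 0 := by
  refine h.ext fun w => ?_
  have hn := h.normal_inner w ξ ξ
  rw [h.map_ξ, h.deriv_map_ξ, h.deriv_map_ξ, h.unit, h.symm (B w), h.deriv_unit, map_neg,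
    neg_apply, h.inner_map_ξ] at hn
  simp only [map_zero, zero_apply] at hn ⊢
  linarith

theorem inner_P_ξ (u v : V) : g (P u v) ξ = g (φ (B u)) v := by
  rw [h.deriv_skew, h.deriv_map_ξ, map_neg, neg_neg, h.symm]

theorem inner_P_ξ_left (u v : V) : g (P ξ u) v = g (φ (B v)) u - g (φ (B u)) v := by
  have hc := h.closed ξ v u
  rw [h.symm v, h.symm ξ, h.symm ξ, h.inner_P_ξ, h.inner_P_ξ] at hc
  linarith

theorem B_φ_φ (u : V) : B (φ (φ u)) = -B u := by
  rw [h.sq, map_add, map_neg, map_smul, h.B_ξ, smul_zero, add_zero]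

theorem inner_B_φ_φ (u v : V) : g (B u) (φ (φ v)) = -g (B u) v := by
  rw [h.sq, map_add, map_neg, map_smul, h.symm _ ξ, h.deriv_unit, smul_zero, add_zero]

theorem B_skew (u v : V) : g (B u) v = -g u (B v) := by
  have skew_on_range : ∀ u w, g (B (φ u)) (φ w) + g (B (φ w)) (φ u) = 0 := fun u w => by
    have hn := h.normal_inner u ξ w
    rw [h.map_ξ, h.deriv_map_ξ, h.deriv_map_ξ, h.inner_P_ξ_left, h.B_ξ, h.symm _ ξ, h.deriv_unit,
      h.skew (B (φ w))] at hn
    simp only [map_neg, neg_apply, map_zero, zero_apply, h.skew (B (φ u)) w] at hn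
    linarith
  have hs := skew_on_range (φ u) (φ v)
  rw [h.B_φ_φ, h.B_φ_φ, map_neg, map_neg, neg_apply, neg_apply, h.inner_B_φ_φ, h.inner_B_φ_φ] at hs
  rw [h.symm u]
  linarith

theorem φ_φ_B (u : V) : φ (φ (B u)) = -B u := by
  rw [h.sq, h.deriv_unit, zero_smul, add_zero]

theorem φ_B (u : V) : φ (B u) = B (φ u) := by
  have φ_B_φ : φ (B (φ u)) = -B u := h.ext fun v => by
    have hn := h.normal_inner u v ξ
    rw [h.map_ξ, h.inner_P_ξ, h.inner_P_ξ, h.unit, map_zero, map_zero, h.skew _ u,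
      h.B_skew (φ v), h.skew v, h.B_skew v, h.symm v, h.symm v] at hn
    simp only [map_neg, neg_apply]
    linarith
  rw [← neg_inj, ← map_neg, ← φ_B_φ, h.φ_φ_B]

theorem φ_B_symm (u v : V) : g (φ (B u)) v = g u (φ (B v)) := by
  rw [h.skew, h.B_skew, h.φ_B, neg_neg]

theorem inner_φ_B_φ (u v : V) : g (φ (B u)) (φ v) = g (B u) v := by
  rw [h.inner_map_map, h.deriv_unit, zero_mul, sub_zero]

theorem inner_P (u v w : V) :
    g (P u v) w = g (φ (B u)) v * g ξ w - g ξ v * g (φ (B u)) w := by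
  set q : V → V → V → ℝ := fun u v w =>
    g (P u v) w - (g (φ (B u)) v * g ξ w - g ξ v * g (φ (B u)) w) with hq
  have q_map_left : ∀ u v w, q u (φ v) w = q u v (φ w) := fun u v w => by
    have hsq := congrArg (fun z => g z w) (h.deriv_sq u v)
    simp only [map_add, map_smul, add_apply, smul_apply, smul_eq_mul, h.skew (P u v)] at hsq
    simp only [hq, h.inner_ξ_map, h.inner_φ_B_φ]
    linarith
  have q_zero : q u v w = 0 := by
    refine eq_zero_of_cyclic_of_normal (f := φ) (q := q) (fun u v w => ?_) q_map_left
      (fun u v w => ?_) (fun u v w => ?_) (fun u v w => ?_) u v w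
    · have hs := h.deriv_skew u v w
      rw [h.symm v] at hs
      simp only [hq]
      linarith
    · rw [q_map_left]
      simp only [hq, h.sq, map_add, map_neg, map_smul, smul_eq_mul, h.inner_P_ξ, h.unit,
        h.inner_map_ξ]
      ring
    · have hc := h.closed u v w
      have hs := h.deriv_skew u v w
      have hs' := h.deriv_skew w u v
      rw [h.symm u] at hc
      simp only [hq, h.φ_B_symm u v, h.φ_B_symm v w, h.φ_B_symm w u, h.symm _ (φ (B _))]
      linarith
    · have hn := h.normal_inner u v w
      simp only [hq, ← h.φ_B, h.φ_φ_B, h.inner_φ_B_φ, h.inner_ξ_map, map_neg, neg_apply]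
      linarith
  exact sub_eq_zero.1 q_zero

theorem P_eq (u v : V) : P u v = g (φ (B u)) v • ξ - g ξ v • φ (B u) := h.ext fun w => by
  simp only [h.inner_P, map_sub, map_smul, sub_apply, smul_apply, smul_eq_mul]

/-- The structure operator of a single quasi-Sasakian structure is only determined up to a multiple
of `η ⊗ ξ`. -/
theorem isStructureOperator (c : ℝ) :
    IsStructureOperator g φ ξ P B (-(φ ∘L B) - c • (g ξ).smulRight ξ) where
  symm u v := by
    simp only [sub_apply, neg_apply, ContinuousLinearMap.comp_apply, smul_apply,
      ContinuousLinearMap.smulRight_apply, map_sub, map_neg, map_smul, smul_eq_mul, h.φ_B_symm,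
      h.symm u ξ]
    ring
  comm u := by
    simp [h.φ_B, h.map_ξ, h.inner_ξ_map]
  deriv_ξ u := by
    simp [h.φ_φ_B, h.map_ξ]
  deriv_φ u v := by
    simp only [h.P_eq, sub_apply, neg_apply, ContinuousLinearMap.comp_apply, smul_apply,
      ContinuousLinearMap.smulRight_apply, map_sub, map_neg, map_smul, smul_eq_mul]
    module

end IsQuasiSasakianJet

namespace IsStructureOperator

variable {g : V →L[ℝ] V →L[ℝ] ℝ} {φ : V →L[ℝ] V} {ξ : V} {P : V →L[ℝ] V →L[ℝ] V}
  {B A : V →L[ℝ] V} (hA : IsStructureOperator g φ ξ P B A)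

include hA

theorem closed (hsymm : ∀ u v, g u v = g v u) (u v w : V) :
    g v (P u w) - g u (P v w) + g u (P w v) = 0 := by
  simp only [hA.deriv_φ, map_sub, map_smul, smul_eq_mul, hA.symm, hsymm v ξ, hsymm u ξ]
  rw [← hA.symm v u, hsymm (A v) u, ← hA.symm w v, hsymm (A w) v]
  ring

variable (h : IsLinearContactMetric g φ ξ)

include h

theorem normal (u v : V) :
    P (φ u) v - P (φ v) u + φ (P v u) - φ (P u v) + (g (B u) v - g (B v) u) • ξ = 0 := by
  simp only [hA.deriv_φ, hA.deriv_ξ, map_sub, map_smul, h.map_ξ, hA.comm]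
  module

theorem inner_B_skew (u v : V) : g (B u) v = -g (B v) u := by
  rw [hA.deriv_ξ, hA.deriv_ξ, h.skew, hA.symm, ← hA.comm, h.symm u]

/-- `dη(v, w) = g(∇_v ξ, w) - g(∇_w ξ, v)`, so this describes the characteristic space of `η`. -/
theorem charSpace_iff (v : V) :
    (g ξ v = 0 ∧ ∀ w, g (B v) w - g (B w) v = 0) ↔ g ξ v = 0 ∧ A v = 0 := by
  refine and_congr_right fun hv => ⟨fun hdη => ?_, fun hAv w => ?_⟩
  · have hφA : φ (A v) = 0 := h.ext fun w => by
      have hw := hdη w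
      rw [hA.inner_B_skew h w v, hA.deriv_ξ] at hw
      rw [map_zero, zero_apply]
      linarith
    have hsq := h.sq (A v)
    rwa [hφA, map_zero, ← hA.symm, h.map_ξ_eq_of_comm hA.comm, map_smul, smul_apply, hv,
      smul_zero, zero_smul, add_zero, zero_eq_neg] at hsq
  · rw [hA.inner_B_skew h w v, hA.deriv_ξ, hAv, map_zero, map_zero, zero_apply, neg_zero, sub_zero]

end IsStructureOperator

end Jet

section ThreeStructure

theorem fin_three_add (α : Fin 3) :
    α + 1 + 1 = α + 2 ∧ α + 1 + 2 = α ∧ α + 2 + 1 = α ∧ α + 2 + 2 = α + 1 := by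
  fin_cases α <;> decide

theorem fin_three_eq (α β : Fin 3) : β = α ∨ β = α + 1 ∨ β = α + 2 := by
  fin_cases α <;> fin_cases β <;> decide

theorem fin_three_eq_zero_of_add_two {X : Type*} {f : Fin 3 → X} (hf : ∀ α, f (α + 2) = f α)
    (α : Fin 3) : f α = f 0 := by
  fin_cases α
  exacts [rfl, (hf 1).symm, hf 0]

/-- A vector space with two anticommuting complex structures is a quaternionic vector space. -/
theorem four_dvd_finrank_of_anticommute {V : Type*} [AddCommGroup V] [Module ℝ V]
    (I J : V →ₗ[ℝ] V) (hI : ∀ v, I (I v) = -v) (hJ : ∀ v, J (J v) = -v)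
    (hIJ : ∀ v, J (I v) = -I (J v)) : 4 ∣ Module.finrank ℝ V := by
  let q : QuaternionAlgebra.Basis (Module.End ℝ V) (-1 : ℝ) (0 : ℝ) (-1 : ℝ) :=
    { i := I
      j := J
      k := I * J
      i_mul_i := by ext v; simp [hI]
      j_mul_j := by ext v; simp [hJ]
      i_mul_j := rfl
      j_mul_i := by ext v; simp [hIJ] }
  let f : Quaternion ℝ →ₐ[ℝ] Module.End ℝ V := q.liftHom
  let _ : Module (Quaternion ℝ) V := Module.compHom V f.toRingHom
  have : IsScalarTower ℝ (Quaternion ℝ) V := ⟨fun r x v => by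
    change f (r • x) v = r • f x v
    rw [map_smul]; rfl⟩
  exact ⟨_, (Quaternion.finrank_eq_four (R := ℝ) ▸
    Module.finrank_mul_finrank ℝ (Quaternion ℝ) V).symm⟩

variable {V : Type*} [AddCommGroup V] [Module ℝ V] [TopologicalSpace V]

/-- An almost contact metric 3-structure `(φ_α, ξ_α, g(ξ_α, ·), g)` on a single vector space. -/
structure IsLinearThreeStructure (g : V →L[ℝ] V →L[ℝ] ℝ) (φ : Fin 3 → V →L[ℝ] V)
    (ξ : Fin 3 → V) : Prop where
  contactMetric : ∀ α, IsLinearContactMetric g (φ α) (ξ α)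
  φ_left : ∀ α v, φ (α + 2) v = φ α (φ (α + 1) v) - g (ξ (α + 1)) v • ξ α
  φ_right : ∀ α v, φ (α + 2) v = -φ (α + 1) (φ α v) + g (ξ α) v • ξ (α + 1)
  ξ_left : ∀ α, ξ (α + 2) = φ α (ξ (α + 1))
  ξ_right : ∀ α, ξ (α + 2) = -φ (α + 1) (ξ α)

namespace IsLinearThreeStructure

variable {g : V →L[ℝ] V →L[ℝ] ℝ} {φ : Fin 3 → V →L[ℝ] V} {ξ : Fin 3 → V}
  (h : IsLinearThreeStructure g φ ξ)

include h

theorem φ_anticomm (α : Fin 3) (v : V) :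
    φ α (φ (α + 1) v) + φ (α + 1) (φ α v) = g (ξ (α + 1)) v • ξ α + g (ξ α) v • ξ (α + 1) := by
  linear_combination (norm := module) h.φ_right α v - h.φ_left α v

theorem φ_ξ_anticomm (α : Fin 3) : φ α (ξ (α + 1)) + φ (α + 1) (ξ α) = 0 := by
  rw [← h.ξ_left, h.ξ_right, neg_add_cancel]

theorem inner_ξ_succ (α : Fin 3) : g (ξ α) (ξ (α + 1)) = 0 := by
  have hξ := h.ξ_left (α + 1)
  rw [(fin_three_add α).2.1] at hξ
  rw [hξ, (h.contactMetric _).inner_map_ξ]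

theorem inner_ξ (α β : Fin 3) : g (ξ α) (ξ β) = if α = β then 1 else 0 := by
  rcases fin_three_eq α β with rfl | rfl | rfl
  · rw [if_pos rfl, (h.contactMetric _).unit]
  · rw [if_neg (by simp), h.inner_ξ_succ]
  · have hξ := h.inner_ξ_succ (α + 2)
    rw [(fin_three_add α).2.2.1, (h.contactMetric 0).symm] at hξ
    rw [if_neg (by simp), hξ]

theorem inner_ξ_map_eq_zero {v : V} (hv : ∀ β, g (ξ β) v = 0) (α β : Fin 3) :
    g (ξ β) (φ α v) = 0 := by
  rw [← neg_eq_zero, ← (h.contactMetric α).skew]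
  have hξ := h.ξ_right (α + 2)
  rw [(fin_three_add α).2.2.1, (fin_three_add α).2.2.2] at hξ
  rcases fin_three_eq α β with rfl | rfl | rfl
  · rw [(h.contactMetric _).map_ξ, map_zero, zero_apply]
  · rw [← h.ξ_left, hv]
  · rw [← neg_eq_iff_eq_neg.2 hξ, map_neg, neg_apply, hv, neg_zero]

theorem four_dvd_finrank_of_invariant (W : Submodule ℝ V) (hW : ∀ α, ∀ v ∈ W, φ α v ∈ W)
    (hξ : ∀ α, ∀ v ∈ W, g (ξ α) v = 0) : 4 ∣ Module.finrank ℝ W := by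
  have hsq : ∀ α, ∀ v ∈ W, φ α (φ α v) = -v := fun α v hv => by
    rw [(h.contactMetric α).sq, hξ α v hv, zero_smul, add_zero]
  refine four_dvd_finrank_of_anticommute ((φ 0).toLinearMap.restrict (hW 0))
    ((φ 1).toLinearMap.restrict (hW 1)) (fun v => Subtype.ext (hsq 0 v v.2))
    (fun v => Subtype.ext (hsq 1 v v.2)) fun v => Subtype.ext ?_
  have hanti := h.φ_anticomm 0 v
  rw [hξ _ v v.2, hξ _ v v.2, zero_smul, zero_smul, add_zero] at hanti
  exact eq_neg_of_add_eq_zero_right hanti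

theorem exists_finrank_eq [FiniteDimensional ℝ V] : ∃ m, Module.finrank ℝ V = 4 * m + 3 := by
  let L : V →ₗ[ℝ] (Fin 3 → ℝ) := LinearMap.pi fun α => (g (ξ α)).toLinearMap
  have hL : Function.Surjective L := fun c => ⟨∑ α, c α • ξ α, by ext β; simp [L, h.inner_ξ]⟩
  have mem_ker : ∀ {v}, v ∈ LinearMap.ker L ↔ ∀ α, g (ξ α) v = 0 := funext_iff
  obtain ⟨m, hm⟩ := h.four_dvd_finrank_of_invariant (LinearMap.ker L)
    (fun α v hv => mem_ker.2 (h.inner_ξ_map_eq_zero (mem_ker.1 hv) α))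
    fun α v hv => mem_ker.1 hv α
  have hrank := L.finrank_range_add_finrank_ker
  rw [LinearMap.range_eq_top.2 hL, finrank_top, Module.finrank_fin_fun, hm] at hrank
  exact ⟨m, by omega⟩

theorem exists_eigenvalue {A : V →L[ℝ] V} (hA : ∀ α u, φ α (A u) = A (φ α u)) :
    ∃ a : ℝ, ∀ α, A (ξ α) = a • ξ α := by
  have map_ξ_succ : ∀ α a, A (ξ (α + 1)) = a • ξ (α + 1) → A (ξ (α + 2)) = a • ξ (α + 2) :=
    fun α a ha => by rw [h.ξ_left, ← hA, ha, map_smul]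
  have h0 := (h.contactMetric 0).map_ξ_eq_of_comm (hA 0)
  have h1 := map_ξ_succ 2 _ h0
  refine ⟨g (ξ 0) (A (ξ 0)), fun α => ?_⟩
  fin_cases α
  exacts [h0, h1, map_ξ_succ 0 _ h1]

end IsLinearThreeStructure

theorem finrank_quotient_of_mem_iff {V : Type*} [AddCommGroup V] [Module ℝ V]
    [FiniteDimensional ℝ V] {η : V →ₗ[ℝ] ℝ} {A : V →ₗ[ℝ] V} {ζ : V} (hζ : A ζ = 0) (hη : η ζ = 1)
    {K : Submodule ℝ V} (hK : ∀ v, v ∈ K ↔ η v = 0 ∧ A v = 0) :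
    Module.finrank ℝ (V ⧸ K) = Module.finrank ℝ (LinearMap.range A) + 1 := by
  let L : V →ₗ[ℝ] LinearMap.range A × ℝ := A.rangeRestrict.prod η
  have hker : LinearMap.ker L = K := by
    rw [LinearMap.ker_prod, LinearMap.ker_rangeRestrict]
    ext v
    rw [hK, Submodule.mem_inf, LinearMap.mem_ker, LinearMap.mem_ker, and_comm]
  have hsurj : Function.Surjective L := by
    rintro ⟨⟨_, v, rfl⟩, c⟩
    refine ⟨v + (c - η v) • ζ, Prod.ext (Subtype.ext ?_) ?_⟩
    · change A (v + (c - η v) • ζ) = A v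
      simp [hζ]
    · change η (v + (c - η v) • ζ) = c
      simp [hη]
  rw [← hker, (L.quotKerEquivOfSurjective hsurj).finrank_eq, Module.finrank_prod,
    Module.finrank_self]

/-- If `A ξ_α = 0`, the range of `A` is a quaternionic space, so that the kernel of `η_α` and `A`
has codimension `1` modulo `4`. -/
theorem IsLinearThreeStructure.eigenvalue_ne_zero [FiniteDimensional ℝ V]
    {g : V →L[ℝ] V →L[ℝ] ℝ} {φ : Fin 3 → V →L[ℝ] V} {ξ : Fin 3 → V}
    (h : IsLinearThreeStructure g φ ξ) {A : V →L[ℝ] V} (symm : ∀ u v, g (A u) v = g u (A v))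
    (comm : ∀ α u, φ α (A u) = A (φ α u)) {a : ℝ} (ha : ∀ α, A (ξ α) = a • ξ α) {α : Fin 3}
    {K : Submodule ℝ V} (hK : ∀ v, v ∈ K ↔ g (ξ α) v = 0 ∧ A v = 0) {l : ℕ}
    (hl : Module.finrank ℝ (V ⧸ K) = 4 * l + 3) : a ≠ 0 := by
  rintro rfl
  have hAξ : ∀ α, A (ξ α) = 0 := fun α => by rw [ha, zero_smul]
  rw [finrank_quotient_of_mem_iff (η := (g (ξ α)).toLinearMap) (A := A.toLinearMap) (hAξ α)
    (h.contactMetric α).unit hK] at hl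
  obtain ⟨m, hm⟩ := h.four_dvd_finrank_of_invariant (LinearMap.range A.toLinearMap)
    (by rintro β _ ⟨v, rfl⟩; exact ⟨φ β v, (comm β v).symm⟩)
    (by rintro β _ ⟨v, rfl⟩
        change g (ξ β) (A v) = 0
        rw [← symm, hAξ, map_zero, zero_apply])
  omega

end ThreeStructure

section ThreeJet

variable {V : Type*} [AddCommGroup V] [Module ℝ V] [TopologicalSpace V] [IsTopologicalAddGroup V]
  [ContinuousSMul ℝ V] {g : V →L[ℝ] V →L[ℝ] ℝ} {φ : Fin 3 → V →L[ℝ] V} {ξ : Fin 3 → V}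

theorem IsLinearThreeStructure.combo (h : IsLinearThreeStructure g φ ξ) {lam : Fin 3 → ℝ}
    (hlam : ∑ α, lam α ^ 2 = 1) :
    IsLinearContactMetric g (∑ α, lam α • φ α) (∑ α, lam α • ξ α) where
  symm := (h.contactMetric 0).symm
  pos := (h.contactMetric 0).pos
  sq v := by
    have h01 : φ 0 (φ 1 v) + φ 1 (φ 0 v) = g (ξ 1) v • ξ 0 + g (ξ 0) v • ξ 1 := h.φ_anticomm 0 v
    have h12 : φ 1 (φ 2 v) + φ 2 (φ 1 v) = g (ξ 2) v • ξ 1 + g (ξ 1) v • ξ 2 := h.φ_anticomm 1 v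
    have h20 : φ 2 (φ 0 v) + φ 0 (φ 2 v) = g (ξ 0) v • ξ 2 + g (ξ 2) v • ξ 0 := h.φ_anticomm 2 v
    rw [Fin.sum_univ_three] at hlam
    simp only [Fin.sum_univ_three, add_apply, smul_apply, map_add, map_smul,
      (h.contactMetric _).sq]
    linear_combination (norm := module) (lam 0 * lam 1) • h01 + (lam 1 * lam 2) • h12 +
      (lam 2 * lam 0) • h20 + hlam • (-v)
  map_ξ := by
    have h01 : φ 0 (ξ 1) + φ 1 (ξ 0) = 0 := h.φ_ξ_anticomm 0
    have h12 : φ 1 (ξ 2) + φ 2 (ξ 1) = 0 := h.φ_ξ_anticomm 1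
    have h20 : φ 2 (ξ 0) + φ 0 (ξ 2) = 0 := h.φ_ξ_anticomm 2
    simp only [Fin.sum_univ_three, add_apply, smul_apply, map_add, map_smul,
      (h.contactMetric _).map_ξ]
    linear_combination (norm := module) (lam 0 * lam 1) • h01 + (lam 1 * lam 2) • h12 +
      (lam 2 * lam 0) • h20
  skew u v := by
    simp only [sum_apply, smul_apply, map_sum, map_smul, (h.contactMetric _).skew, smul_neg,
      Finset.sum_neg_distrib]
  unit := by
    simpa [h.inner_ξ, pow_two] using hlam

/-- The pointwise identities satisfied by `P_α = ∇φ_α` and `B_α = ∇ξ_α` for a 3-quasi-Sasakian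
structure: those of its three members and the derivative of `ξ_γ = φ_α ξ_β`. -/
structure IsThreeQuasiSasakianJet (g : V →L[ℝ] V →L[ℝ] ℝ) (φ : Fin 3 → V →L[ℝ] V)
    (ξ : Fin 3 → V) (P : Fin 3 → V →L[ℝ] V →L[ℝ] V) (B : Fin 3 → V →L[ℝ] V) : Prop
    extends IsLinearThreeStructure g φ ξ where
  jet : ∀ α, IsQuasiSasakianJet g (φ α) (ξ α) (P α) (B α)
  deriv_ξ_left : ∀ α u, B (α + 2) u = P α u (ξ (α + 1)) + φ α (B (α + 1) u)

namespace IsThreeQuasiSasakianJet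

variable {P : Fin 3 → V →L[ℝ] V →L[ℝ] V} {B : Fin 3 → V →L[ℝ] V}
  (h : IsThreeQuasiSasakianJet g φ ξ P B)

include h

theorem B_eq (α : Fin 3) (u : V) :
    B α u = φ (α + 1) (B (α + 2) u) - g (B (α + 1) u) (ξ α) • ξ (α + 1) := by
  obtain ⟨h11, h12, -, -⟩ := fin_three_add α
  have hB := h.deriv_ξ_left (α + 1) u
  have hξ := h.ξ_left (α + 1)
  have hinner := h.inner_ξ_succ (α + 1)
  rw [h12, h11] at hB hξ
  rw [h11] at hinner
  rw [(h.jet (α + 1)).P_eq, hinner, zero_smul, (h.jet _).skew, ← hξ] at hB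
  rw [hB]
  module

theorem inner_B_ξ_succ (α : Fin 3) (u : V) :
    g (B α u) (ξ (α + 1)) = -g (B (α + 1) u) (ξ α) := by
  rw [h.B_eq α u, map_sub, map_smul, sub_apply, smul_apply, (h.jet _).unit,
    (h.jet _).inner_map_ξ, smul_eq_mul, mul_one, zero_sub]

theorem φ_B_sub_φ_B (α : Fin 3) (u : V) : φ (α + 2) (B (α + 2) u) - φ α (B α u) =
    g (B (α + 1) u) (ξ (α + 2)) • ξ α - g (B α u) (ξ (α + 1)) • ξ (α + 2) := by
  have hinner := h.inner_B_ξ_succ (α + 1) u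
  rw [(fin_three_add α).1] at hinner
  rw [h.φ_left α, h.B_eq α u, map_sub, map_smul, ← h.ξ_left, ← h.B_eq, hinner,
    h.inner_B_ξ_succ, (h.jet 0).symm (ξ (α + 1)) (B (α + 2) u)]
  module

theorem inner_B_succ_ξ (α : Fin 3) (u : V) :
    g (B (α + 1) u) (ξ (α + 2)) = g (B (α + 1) (ξ α)) (ξ (α + 2)) * g (ξ α) u := by
  have hu := congrArg (fun z => g z (ξ α)) (h.φ_B_sub_φ_B α u)
  have hξ := congrArg (fun z => g z u) (h.φ_B_sub_φ_B α (ξ α))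
  have horth : g (ξ (α + 2)) (ξ α) = 0 := by rw [h.inner_ξ, if_neg (by simp)]
  simp only [map_sub, map_smul, sub_apply, smul_apply, smul_eq_mul, horth, (h.jet _).unit] at hu hξ
  rw [(h.jet _).φ_B_symm, (h.jet _).φ_B_symm, (h.jet 0).symm u, (h.jet 0).symm u, hξ,
    (h.jet α).B_ξ, map_zero, zero_apply] at hu
  linarith

theorem exists_inner_B_succ_ξ_eq :
    ∃ c : ℝ, ∀ α u, g (B (α + 1) u) (ξ (α + 2)) = c * g (ξ α) u := by
  refine ⟨g (B (0 + 1) (ξ 0)) (ξ (0 + 2)), fun α u => ?_⟩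
  rw [h.inner_B_succ_ξ, fin_three_eq_zero_of_add_two
    (f := fun α => g (B (α + 1) (ξ α)) (ξ (α + 2))) (fun α => ?_) α]
  obtain ⟨-, -, h21, h22⟩ := fin_three_add α
  rw [h21, h22, h.inner_B_ξ_succ, (h.jet _).B_skew, neg_neg, (h.jet 0).symm]

theorem exists_isStructureOperator :
    ∃ A : V →L[ℝ] V, ∀ α, IsStructureOperator g (φ α) (ξ α) (P α) (B α) A := by
  obtain ⟨c, hc⟩ := h.exists_inner_B_succ_ξ_eq
  let A (α : Fin 3) : V →L[ℝ] V := -(φ α ∘L B α) - c • (g (ξ α)).smulRight (ξ α)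
  have hA : ∀ α, A α = A 0 := fin_three_eq_zero_of_add_two fun α => by
    ext u
    have hsub := h.φ_B_sub_φ_B α u
    have hc' := hc (α + 2) u
    rw [(fin_three_add α).2.2.1, (fin_three_add α).2.2.2] at hc'
    rw [hc, hc'] at hsub
    simp only [A, sub_apply, neg_apply, ContinuousLinearMap.comp_apply, smul_apply,
      ContinuousLinearMap.smulRight_apply]
    linear_combination (norm := module) (-1 : ℝ) • hsub
  exact ⟨A 0, fun α => hA α ▸ (h.jet α).isStructureOperator c⟩

end IsThreeQuasiSasakianJet

theorem IsStructureOperator.combo {ι : Type*} [Fintype ι] [Nonempty ι] {g : V →L[ℝ] V →L[ℝ] ℝ}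
    {φ : ι → V →L[ℝ] V} {ξ : ι → V} {P : ι → V →L[ℝ] V →L[ℝ] V} {B : ι → V →L[ℝ] V}
    {A : V →L[ℝ] V} (hA : ∀ i, IsStructureOperator g (φ i) (ξ i) (P i) (B i) A) (c : ι → ℝ) :
    IsStructureOperator g (∑ i, c i • φ i) (∑ i, c i • ξ i) (∑ i, c i • P i) (∑ i, c i • B i)
      A where
  symm := (hA (Classical.arbitrary ι)).symm
  comm u := by simp [(hA _).comm]
  deriv_ξ u := by simp [(hA _).deriv_ξ]
  deriv_φ u v := by
    simp [(hA _).deriv_φ, smul_sub, Finset.sum_sub_distrib, Finset.sum_smul, smul_smul,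
      Finset.smul_sum, mul_comm]

end ThreeJet

section Wedge

open Equiv

variable {V : Type*} [AddCommGroup V] [Module ℝ V]

/-- The summand of the permutation `σ` in the antisymmetrization of `a ⊗ b`. -/
def shuffleTerm {p q : ℕ} (a : V [⋀^Fin p]→ₗ[ℝ] ℝ) (b : V [⋀^Fin q]→ₗ[ℝ] ℝ)
    (u : Fin p ⊕ Fin q → V) (σ : Perm (Fin p ⊕ Fin q)) : ℝ :=
  ((Perm.sign σ : ℤ) : ℝ) * (a (u ∘ σ ∘ Sum.inl) * b (u ∘ σ ∘ Sum.inr))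

variable {p q : ℕ} (a : V [⋀^Fin p]→ₗ[ℝ] ℝ) (b : V [⋀^Fin q]→ₗ[ℝ] ℝ) (u : Fin p ⊕ Fin q → V)

theorem factorial_mul_factorial_mul_wedge :
    (p.factorial * q.factorial : ℝ) * wedge a b (u ∘ finSumFinEquiv.symm) =
      ∑ σ, shuffleTerm a b u σ := by
  have h := congrArg (fun m : V [⋀^Fin p ⊕ Fin q]→ₗ[ℝ] TensorProduct ℝ ℝ ℝ =>
    LinearMap.mul' ℝ ℝ (m u)) (MultilinearMap.domCoprod_alternization_eq a b)
  simp only [MultilinearMap.alternatization_apply, map_sum, Fintype.card_fin,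
    AlternatingMap.smul_apply, map_nsmul] at h
  have hu : (u ∘ finSumFinEquiv.symm) ∘ finSumFinEquiv = u := by ext x; simp
  rw [wedge, AlternatingMap.domDomCongr_apply, hu, ← Nat.cast_mul, ← nsmul_eq_mul]
  refine h.symm.trans (Finset.sum_congr rfl fun σ _ => ?_)
  rw [Units.smul_def, map_zsmul, zsmul_eq_mul]
  rfl

theorem shuffleTerm_one :
    shuffleTerm a b u 1 = a (u ∘ Sum.inl) * b (u ∘ Sum.inr) := by
  simp [shuffleTerm, Function.comp_def]

theorem shuffleTerm_comp (ρ σ : Perm (Fin p ⊕ Fin q)) :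
    shuffleTerm a b (u ∘ ρ) σ = (Perm.sign ρ : ℤ) * shuffleTerm a b u (ρ * σ) := by
  have hρ : ((Perm.sign ρ : ℤ) : ℝ) * (Perm.sign ρ : ℤ) = 1 :=
    mod_cast Int.units_coe_mul_self (Perm.sign ρ)
  simp only [shuffleTerm, Perm.sign_mul, Units.val_mul, Int.cast_mul, ← mul_assoc, hρ, one_mul]
  rfl

theorem shuffleTerm_of_mapsTo {σ : Perm (Fin p ⊕ Fin q)}
    (hσ : MapsTo σ (range Sum.inl) (range Sum.inl)) :
    shuffleTerm a b u σ = shuffleTerm a b u 1 := by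
  obtain ⟨⟨σ₁, σ₂⟩, rfl⟩ := Perm.mem_sumCongrHom_range_of_perm_mapsTo_inl hσ
  have ha : a (u ∘ Perm.sumCongrHom _ _ (σ₁, σ₂) ∘ Sum.inl) =
      (Perm.sign σ₁ : ℤ) * a (u ∘ Sum.inl) :=
    (a.map_perm (u ∘ Sum.inl) σ₁).trans (by rw [Units.smul_def, zsmul_eq_mul])
  have hb : b (u ∘ Perm.sumCongrHom _ _ (σ₁, σ₂) ∘ Sum.inr) =
      (Perm.sign σ₂ : ℤ) * b (u ∘ Sum.inr) :=
    (b.map_perm (u ∘ Sum.inr) σ₂).trans (by rw [Units.smul_def, zsmul_eq_mul])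
  have hsq (s : ℤˣ) : ((s : ℤ) : ℝ) * (s : ℤ) = 1 := mod_cast Int.units_coe_mul_self s
  rw [shuffleTerm_one, shuffleTerm, ha, hb, Perm.sumCongrHom_apply, Perm.sign_sumCongr,
    Units.val_mul, Int.cast_mul]
  linear_combination a (u ∘ Sum.inl) * b (u ∘ Sum.inr) *
    (((Perm.sign σ₂ : ℤ) : ℝ) * (Perm.sign σ₂ : ℤ) * hsq (Perm.sign σ₁) + hsq (Perm.sign σ₂))

variable {a b u}

theorem wedge_pos (h : ∀ σ, 0 ≤ shuffleTerm a b u σ) (h1 : 0 < shuffleTerm a b u 1) :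
    0 < wedge a b (u ∘ finSumFinEquiv.symm) := by
  have hsum : 0 < ∑ σ, shuffleTerm a b u σ :=
    h1.trans_le (Finset.single_le_sum (fun σ _ => h σ) (Finset.mem_univ 1))
  rw [← factorial_mul_factorial_mul_wedge] at hsum
  exact pos_of_mul_pos_right hsum (by positivity)

/-- `b (i, 0), b (i, 1)` are hyperbolic pairs of the 2-form `θ`, orthogonal to each other. -/
structure IsHyperbolic {ι : Type*} (θ : V [⋀^Fin 2]→ₗ[ℝ] ℝ) (b : ι × Fin 2 → V) : Prop where
  pos : ∀ i, 0 < θ ![b (i, 0), b (i, 1)]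
  orthogonal : ∀ x y : ι × Fin 2, x.1 ≠ y.1 → θ ![b x, b y] = 0

theorem IsHyperbolic.comp {ι κ : Type*} {θ : V [⋀^Fin 2]→ₗ[ℝ] ℝ} {b : ι × Fin 2 → V}
    (h : IsHyperbolic θ b) {s : κ → ι} (hs : s.Injective) :
    IsHyperbolic θ (b ∘ Prod.map s id) where
  pos i := h.pos (s i)
  orthogonal x y hxy := h.orthogonal (Prod.map s id x) (Prod.map s id y) (hs.ne hxy)

/-- The enumeration `(0, 0), (0, 1), (1, 0), (1, 1), …` of `Fin n × Fin 2`. -/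
def pairEquiv (n : ℕ) : Fin (2 * n) ≃ Fin n × Fin 2 :=
  (finCongr (mul_comm 2 n)).trans finProdFinEquiv.symm

theorem pairEquiv_finSumFinEquiv_inl {n : ℕ} (i : Fin (2 * n)) :
    pairEquiv (n + 1) (finSumFinEquiv (Sum.inl i : Fin (2 * n) ⊕ Fin 2)) =
      Prod.map Fin.castSucc id (pairEquiv n i) := by
  ext <;> rfl

theorem pairEquiv_finSumFinEquiv_inr {n : ℕ} (j : Fin 2) :
    pairEquiv (n + 1) (finSumFinEquiv (Sum.inr j : Fin (2 * n) ⊕ Fin 2)) = (Fin.last n, j) := by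
  have h1 : (2 * n + (j : ℕ)) / 2 = n := by omega
  have h2 : (2 * n + (j : ℕ)) % 2 = j := by omega
  exact Prod.ext (Fin.ext h1) (Fin.ext h2)

theorem shuffleTerm_wedgePow_one_pos {θ : V [⋀^Fin 2]→ₗ[ℝ] ℝ} {n : ℕ}
    (ih : ∀ c : Fin n × Fin 2 → V, IsHyperbolic θ c → 0 < wedgePow θ n (c ∘ pairEquiv n))
    {b : Fin (n + 1) × Fin 2 → V} (hb : IsHyperbolic θ b) :
    0 < shuffleTerm (wedgePow θ n) θ (b ∘ finSumFinEquiv.trans (pairEquiv (n + 1))) 1 := by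
  have hl : (b ∘ finSumFinEquiv.trans (pairEquiv (n + 1))) ∘ Sum.inl =
      (b ∘ Prod.map Fin.castSucc id) ∘ pairEquiv n :=
    funext fun i => congrArg b (pairEquiv_finSumFinEquiv_inl i)
  have hr : (b ∘ finSumFinEquiv.trans (pairEquiv (n + 1))) ∘ Sum.inr =
      ![b (Fin.last n, 0), b (Fin.last n, 1)] := by
    ext j
    fin_cases j <;> exact congrArg b (pairEquiv_finSumFinEquiv_inr _)
  rw [shuffleTerm_one, hl, hr]
  exact mul_pos (ih _ (hb.comp (Fin.castSucc_injective n))) (hb.pos _)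

/-- The terms in which the last two vectors come from different pairs vanish; the others reduce to
the identity term after exchanging that pair with the last one, which is an even permutation. -/
theorem shuffleTerm_wedgePow_nonneg {θ : V [⋀^Fin 2]→ₗ[ℝ] ℝ} {n : ℕ}
    (ih : ∀ c : Fin n × Fin 2 → V, IsHyperbolic θ c → 0 < wedgePow θ n (c ∘ pairEquiv n))
    {b : Fin (n + 1) × Fin 2 → V} (hb : IsHyperbolic θ b) (σ : Perm (Fin (2 * n) ⊕ Fin 2)) :
    0 ≤ shuffleTerm (wedgePow θ n) θ (b ∘ finSumFinEquiv.trans (pairEquiv (n + 1))) σ := by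
  set e := finSumFinEquiv.trans (pairEquiv (n + 1))
  rcases ne_or_eq (e (σ (Sum.inr 0))).1 (e (σ (Sum.inr 1))).1 with hne | heq
  · have hθ : θ ((b ∘ e) ∘ σ ∘ Sum.inr) = 0 := by
      rw [← hb.orthogonal _ _ hne]
      congr 1
      ext j
      fin_cases j <;> rfl
    rw [shuffleTerm, hθ, mul_zero, mul_zero]
  · set s := swap (e (σ (Sum.inr 0))).1 (Fin.last n)
    let ρ : Perm (Fin (2 * n) ⊕ Fin 2) := e.symm.permCongr (prodCongrLeft fun _ => s)
    have hρ (x) : e (ρ x) = Prod.map s id (e x) := e.apply_symm_apply _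
    have hsign : Perm.sign ρ = 1 := by
      rw [Perm.sign_permCongr, Perm.sign_prodCongrLeft, Fin.prod_univ_two, Int.units_mul_self]
    have hbρ : b ∘ e = ((b ∘ Prod.map s id) ∘ e) ∘ ρ := by
      ext x
      simp [s, hρ, Prod.map]
    have hmaps : MapsTo (ρ * σ) (range Sum.inr) (range Sum.inr) := by
      rintro _ ⟨j, rfl⟩
      have hj : (e (σ (Sum.inr j))).1 = (e (σ (Sum.inr 0))).1 := by
        fin_cases j
        exacts [rfl, heq.symm]
      refine ⟨(e (σ (Sum.inr j))).2, e.injective ?_⟩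
      rw [Perm.mul_apply, hρ, Prod.map, hj, swap_apply_left]
      exact pairEquiv_finSumFinEquiv_inr _
    rw [hbρ, shuffleTerm_comp, hsign,
      shuffleTerm_of_mapsTo _ _ _ ((Perm.perm_mapsTo_inl_iff_mapsTo_inr _).2 hmaps)]
    simpa only [Units.val_one, Int.cast_one, one_mul] using
      (shuffleTerm_wedgePow_one_pos ih (hb.comp s.injective)).le

theorem wedgePow_pos {θ : V [⋀^Fin 2]→ₗ[ℝ] ℝ} :
    ∀ {n : ℕ} {b : Fin n × Fin 2 → V}, IsHyperbolic θ b → 0 < wedgePow θ n (b ∘ pairEquiv n)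
  | 0, _, _ => by simp [wedgePow]
  | n + 1, b, hb => by
    have h := wedge_pos (shuffleTerm_wedgePow_nonneg (fun _ => wedgePow_pos) hb)
      (shuffleTerm_wedgePow_one_pos (fun _ => wedgePow_pos) hb)
    rwa [Function.comp_assoc, coe_trans, Function.comp_assoc, self_comp_symm] at h

theorem wedge_wedgePow_ne_zero {a : V [⋀^Fin 1]→ₗ[ℝ] ℝ} {θ : V [⋀^Fin 2]→ₗ[ℝ] ℝ} {n : ℕ}
    {b : Fin n × Fin 2 → V} (hb : IsHyperbolic θ b) (hab : ∀ x, a (fun _ => b x) = 0) {ζ : V}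
    (hζ : 0 < a fun _ => ζ) : wedge a (wedgePow θ n) ≠ 0 := by
  let u : Fin 1 ⊕ Fin (2 * n) → V := Sum.elim (fun _ => ζ) (b ∘ pairEquiv n)
  have hpos : 0 < shuffleTerm a (wedgePow θ n) u 1 := by
    rw [shuffleTerm_one]
    exact mul_pos hζ (wedgePow_pos hb)
  have hnonneg (σ : Perm (Fin 1 ⊕ Fin (2 * n))) : 0 ≤ shuffleTerm a (wedgePow θ n) u σ := by
    rcases hσ : σ (Sum.inl 0) with i | i
    · have hmaps : MapsTo σ (range Sum.inl) (range Sum.inl) := by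
        rintro _ ⟨j, rfl⟩
        exact ⟨i, by rw [Subsingleton.elim j 0, hσ]⟩
      rw [shuffleTerm_of_mapsTo _ _ _ hmaps]
      exact hpos.le
    · have hau : a (u ∘ σ ∘ Sum.inl) = 0 := by
        rw [← hab (pairEquiv n i)]
        congr 1
        ext j
        simp only [Function.comp_apply, Subsingleton.elim j 0, hσ, u, Sum.elim_inr]
      rw [shuffleTerm, hau, zero_mul, mul_zero]
  intro h0
  have h := wedge_pos hnonneg hpos
  rw [h0] at h
  exact lt_irrefl _ h

end Wedge

section ContactVolume

variable {V : Type*} [AddCommGroup V] [Module ℝ V] [TopologicalSpace V]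
  {g : V →L[ℝ] V →L[ℝ] ℝ} {φ : V →L[ℝ] V} {ξ : V}

theorem exists_ne_zero_orthogonal (g : V →L[ℝ] V →L[ℝ] ℝ) (φ : V →L[ℝ] V) (ξ : V) {m : ℕ}
    (e : Fin m → V) (hm : 2 * m + 1 < Module.finrank ℝ V) :
    ∃ v ≠ 0, g ξ v = 0 ∧ ∀ i, g (e i) v = 0 ∧ g (φ (e i)) v = 0 := by
  have : FiniteDimensional ℝ V := .of_finrank_pos (by omega)
  let L : V →ₗ[ℝ] ℝ × (Fin m → ℝ × ℝ) := (g ξ).toLinearMap.prod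
    (LinearMap.pi fun i => (g (e i)).toLinearMap.prod (g (φ (e i))).toLinearMap)
  have hL : LinearMap.ker L ≠ ⊥ := LinearMap.ker_ne_bot_of_finrank_lt (by
    simp only [Module.finrank_prod, Module.finrank_pi_fintype, Module.finrank_self,
      Finset.sum_const, Finset.card_univ, Fintype.card_fin, smul_eq_mul]
    omega)
  obtain ⟨v, hv, hv0⟩ := (Submodule.ne_bot_iff _).1 hL
  exact ⟨v, hv0, congrArg Prod.fst hv, fun i =>
    ⟨congrArg (fun z => (z.2 i).1) hv, congrArg (fun z => (z.2 i).2) hv⟩⟩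

theorem IsLinearContactMetric.exists_orthogonal_system (h : IsLinearContactMetric g φ ξ) :
    ∀ {m : ℕ}, 2 * m < Module.finrank ℝ V → ∃ e : Fin m → V,
      (∀ i, e i ≠ 0 ∧ g ξ (e i) = 0) ∧
      ∀ i j, i ≠ j → g (e i) (e j) = 0 ∧ g (e i) (φ (e j)) = 0
  | 0, _ => ⟨Fin.elim0, fun i => i.elim0, fun i => i.elim0⟩
  | m + 1, hm => by
    obtain ⟨e, he, ho⟩ := h.exists_orthogonal_system (m := m) (by omega)
    obtain ⟨v, hv, hξv, hev⟩ := exists_ne_zero_orthogonal g φ ξ e (by omega)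
    refine ⟨Fin.snoc e v, fun i => ?_, fun i j hij => ?_⟩
    · cases i using Fin.lastCases with
      | last => simpa using ⟨hv, hξv⟩
      | cast i => simpa using he i
    · cases i using Fin.lastCases with
      | last =>
        cases j using Fin.lastCases with
        | last => exact absurd rfl hij
        | cast j =>
          simpa [h.symm v] using (hev j)
      | cast i =>
        cases j using Fin.lastCases with
        | last => simpa [eq_neg_iff_add_eq_zero, h.skew] using hev i
        | cast j => simpa using ho i j fun hij' => hij (congrArg _ hij')

/-- In a unitary frame `(φ e₁, e₁, …, φ eₙ, eₙ)` of `ker η` the fundamental form is hyperbolic. -/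
theorem IsLinearContactMetric.wedge_ne_zero (h : IsLinearContactMetric g φ ξ) {n : ℕ}
    (hn : Module.finrank ℝ V = 2 * n + 1) {a : V [⋀^Fin 1]→ₗ[ℝ] ℝ} {θ : V [⋀^Fin 2]→ₗ[ℝ] ℝ}
    (ha : ∀ v, a (fun _ => v) = g ξ v) (hθ : ∀ u v, θ ![u, v] = g u (φ v)) :
    wedge a (wedgePow θ n) ≠ 0 := by
  obtain ⟨e, he, ho⟩ := h.exists_orthogonal_system (m := n) (by omega)
  have hsq (i) : φ (φ (e i)) = -e i := by rw [h.sq, (he i).2, zero_smul, add_zero]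
  let b : Fin n × Fin 2 → V := fun x => ![φ (e x.1), e x.1] x.2
  have hpos (i) : 0 < θ ![b (i, 0), b (i, 1)] := by
    rw [hθ]
    change 0 < g (φ (e i)) (φ (e i))
    rw [h.inner_map_map, (he i).2, mul_zero, sub_zero]
    exact h.pos _ (he i).1
  have horth (x y : Fin n × Fin 2) (hxy : x.1 ≠ y.1) : θ ![b x, b y] = 0 := by
    obtain ⟨i, k⟩ := x
    obtain ⟨j, l⟩ := y
    obtain ⟨h1, h2⟩ := ho i j hxy
    rw [hθ]
    fin_cases k <;> fin_cases l <;> simp [b, h1, h2, hsq, h.inner_map_map, h.skew, (he _).2]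
  have hab (x) : a (fun _ => b x) = 0 := by
    obtain ⟨i, j⟩ := x
    fin_cases j
    exacts [(ha _).trans (h.inner_ξ_map _), (ha _).trans (he i).2]
  exact wedge_wedgePow_ne_zero ⟨hpos, horth⟩ hab (ζ := ξ) (by rw [ha, h.unit]; exact one_pos)

end ContactVolume

section Chart

variable {E : Type*} [NormedAddCommGroup E] [NormedSpace ℝ E]
  {M : Type*} [TopologicalSpace M] [ChartedSpace E M] {x₀ : M} {y : E}

/-- The derivative of the inverse of the preferred chart at `x₀`. -/
def chartD (x₀ : M) (y : E) : E →L[ℝ] E :=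
  mfderiv 𝓘(ℝ, E) 𝓘(ℝ, E) (extChartAt 𝓘(ℝ, E) x₀).symm y

/-- The derivative of the preferred chart at `x₀`, at the point with coordinates `y`. -/
def chartDInv (x₀ : M) (y : E) : E →L[ℝ] E :=
  mfderiv 𝓘(ℝ, E) 𝓘(ℝ, E) (extChartAt 𝓘(ℝ, E) x₀) ((extChartAt 𝓘(ℝ, E) x₀).symm y)

/-- A vector field in the preferred chart at `x₀`. -/
def VField.chart (X : VField E M) (x₀ : M) (y : E) : E :=
  chartDInv x₀ y (X ((extChartAt 𝓘(ℝ, E) x₀).symm y))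

/-- A field of endomorphisms in the preferred chart at `x₀`. -/
def EndField.chart (φ : EndField E M) (x₀ : M) (y : E) : E →L[ℝ] E :=
  chartDInv x₀ y ∘L (show E →L[ℝ] E from φ ((extChartAt 𝓘(ℝ, E) x₀).symm y)) ∘L chartD x₀ y

/-- The coordinate vector field of the preferred chart at `x₀` in the direction `u`. -/
def coordField (x₀ : M) (u : E) : VField E M :=
  fun x => chartD x₀ (extChartAt 𝓘(ℝ, E) x₀ x) u

theorem coordField_symm (hy : y ∈ (extChartAt 𝓘(ℝ, E) x₀).target) (u : E) :
    coordField x₀ u ((extChartAt 𝓘(ℝ, E) x₀).symm y) = chartD x₀ y u := by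
  rw [coordField, (extChartAt 𝓘(ℝ, E) x₀).right_inv hy]

theorem mapsTo_extChartAt_symm (x₀ : M) :
    MapsTo (extChartAt 𝓘(ℝ, E) x₀).symm (extChartAt 𝓘(ℝ, E) x₀).target (chartAt E x₀).source :=
  extChartAt_source (I := 𝓘(ℝ, E)) x₀ ▸ (extChartAt 𝓘(ℝ, E) x₀).mapsTo_symm

theorem DForm.IsSmooth.differentiableAt_inChart {k : ℕ} {θ : DForm E M k} (hθ : θ.IsSmooth)
    (x₀ : M) : DifferentiableAt ℝ (θ.inChart x₀) (extChartAt 𝓘(ℝ, E) x₀ x₀) :=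
  ((hθ x₀).contDiffAt (extChartAt_target_mem_nhds x₀)).differentiableAt (by simp)

variable [IsManifold 𝓘(ℝ, E) ∞ M]

/-- A Riemannian metric in the preferred chart at `x₀`. -/
def chartMetric (g : RMetric E M) (x₀ : M) (y : E) : E →L[ℝ] E →L[ℝ] ℝ :=
  ContinuousLinearMap.bilinearComp
    (show E →L[ℝ] E →L[ℝ] ℝ from g.inner ((extChartAt 𝓘(ℝ, E) x₀).symm y))
    (chartD x₀ y) (chartD x₀ y)

theorem chartMetric_apply (g : RMetric E M) (x₀ : M) (y u v : E) :
    chartMetric g x₀ y u v =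
      g.inner ((extChartAt 𝓘(ℝ, E) x₀).symm y) (chartD x₀ y u) (chartD x₀ y v) := rfl

theorem chartDInv_chartD (hy : y ∈ (extChartAt 𝓘(ℝ, E) x₀).target) (v : E) :
    chartDInv x₀ y (chartD x₀ y v) = v := by
  have h := mfderiv_extChartAt_comp_mfderivWithin_extChartAt_symm (I := 𝓘(ℝ, E)) hy
  rw [ModelWithCorners.range_eq_univ, mfderivWithin_univ] at h
  exact DFunLike.congr_fun h v

theorem chartD_chartDInv (hy : y ∈ (extChartAt 𝓘(ℝ, E) x₀).target) (v : E) :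
    chartD x₀ y (chartDInv x₀ y v) = v := by
  have h := mfderivWithin_extChartAt_symm_comp_mfderiv_extChartAt (I := 𝓘(ℝ, E)) hy
  rw [ModelWithCorners.range_eq_univ, mfderivWithin_univ] at h
  exact DFunLike.congr_fun h v

theorem chartD_injective (hy : y ∈ (extChartAt 𝓘(ℝ, E) x₀).target) :
    Function.Injective (chartD x₀ y) :=
  Function.LeftInverse.injective (chartDInv_chartD hy)

theorem chartD_chart_vField (ξ : VField E M) (hy : y ∈ (extChartAt 𝓘(ℝ, E) x₀).target) :
    chartD x₀ y (ξ.chart x₀ y) = ξ ((extChartAt 𝓘(ℝ, E) x₀).symm y) :=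
  chartD_chartDInv hy _

theorem chartD_chart_endField (φ : EndField E M) (hy : y ∈ (extChartAt 𝓘(ℝ, E) x₀).target)
    (v : E) :
    chartD x₀ y (φ.chart x₀ y v) = φ ((extChartAt 𝓘(ℝ, E) x₀).symm y) (chartD x₀ y v) :=
  chartD_chartDInv hy _

theorem VField.chart_map_eventuallyEq (φ : EndField E M) (X : VField E M) (x₀ : M) :
    VField.chart (fun x => φ x (X x)) x₀ =ᶠ[𝓝 (extChartAt 𝓘(ℝ, E) x₀ x₀)]
      fun y => φ.chart x₀ y (X.chart x₀ y) := by
  filter_upwards [extChartAt_target_mem_nhds x₀] with y hy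
  apply chartD_injective hy
  rw [chartD_chart_endField φ hy, chartD_chart_vField _ hy, chartD_chart_vField _ hy]

theorem chartD_self (x₀ : M) :
    chartD x₀ (extChartAt 𝓘(ℝ, E) x₀ x₀) = ContinuousLinearMap.id ℝ E := by
  have h := mfderivWithin_range_extChartAt_symm (I := 𝓘(ℝ, E)) (x := x₀)
  rwa [ModelWithCorners.range_eq_univ, mfderivWithin_univ] at h

theorem chartDInv_self (x₀ : M) :
    chartDInv x₀ (extChartAt 𝓘(ℝ, E) x₀ x₀) = ContinuousLinearMap.id ℝ E := by
  ext v
  have h := chartDInv_chartD (mem_extChartAt_target (I := 𝓘(ℝ, E)) x₀) v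
  rwa [chartD_self] at h

-- The fibre type of the three fields below depends on the base point, so the equation
-- `(extChartAt _ x₀).symm (extChartAt _ x₀ x₀) = x₀` is transported by `rintro _ rfl`.
theorem VField.chart_self (X : VField E M) (x₀ : M) :
    X.chart x₀ (extChartAt 𝓘(ℝ, E) x₀ x₀) = X x₀ := by
  have h : ∀ z : M, z = x₀ → (X z : E) = X x₀ := by rintro _ rfl; rfl
  rw [VField.chart, chartDInv_self]
  exact h _ (extChartAt_to_inv (I := 𝓘(ℝ, E)) x₀)

theorem EndField.chart_self (φ : EndField E M) (x₀ : M) :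
    φ.chart x₀ (extChartAt 𝓘(ℝ, E) x₀ x₀) = (φ x₀ : E →L[ℝ] E) := by
  have h : ∀ z : M, z = x₀ → (show E →L[ℝ] E from φ z) = φ x₀ := by rintro _ rfl; rfl
  rw [EndField.chart, chartDInv_self, chartD_self]
  exact h _ (extChartAt_to_inv (I := 𝓘(ℝ, E)) x₀)

theorem chartMetric_self (g : RMetric E M) (x₀ : M) :
    chartMetric g x₀ (extChartAt 𝓘(ℝ, E) x₀ x₀) = (g.inner x₀ : E →L[ℝ] E →L[ℝ] ℝ) := by
  have h : ∀ z : M, z = x₀ → (show E →L[ℝ] E →L[ℝ] ℝ from g.inner z) = g.inner x₀ := by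
    rintro _ rfl; rfl
  rw [chartMetric, chartD_self]
  exact h _ (extChartAt_to_inv (I := 𝓘(ℝ, E)) x₀)

theorem VField.contDiffOn_chart {X : VField E M}
    (hX : ContMDiffOn 𝓘(ℝ, E) (𝓘(ℝ, E).prod 𝓘(ℝ, E)) ∞
      (fun x => (TotalSpace.mk' E x (X x) : TangentBundle 𝓘(ℝ, E) M)) (chartAt E x₀).source) :
    ContDiffOn ℝ ∞ (X.chart x₀) (extChartAt 𝓘(ℝ, E) x₀).target := by
  let e := trivializationAt E (TangentSpace 𝓘(ℝ, E) : M → Type _) x₀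
  have smooth_snd : ContMDiffOn 𝓘(ℝ, E) 𝓘(ℝ, E) ∞ (fun x => (e ⟨x, X x⟩).2) e.baseSet :=
    (e.contMDiffOn_section_baseSet_iff (IB := 𝓘(ℝ, E)) (n := ∞)).1 hX
  have smooth_comp := smooth_snd.comp (contMDiffOn_extChartAt_symm (n := ∞) x₀)
    (mapsTo_extChartAt_symm x₀)
  refine (contMDiffOn_iff_contDiffOn.1 smooth_comp).congr fun y hy => ?_
  have hsrc := mapsTo_extChartAt_symm x₀ hy
  have h := DFunLike.congr_fun
    (TangentBundle.continuousLinearMapAt_trivializationAt (I := 𝓘(ℝ, E)) hsrc)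
    (X ((extChartAt 𝓘(ℝ, E) x₀).symm y))
  refine h.symm.trans ?_
  rw [Trivialization.continuousLinearMapAt_apply, Trivialization.linearMapAt_apply, if_pos]
  · rfl
  · exact hsrc

theorem contMDiffOn_coordField (x₀ : M) (u : E) :
    ContMDiffOn 𝓘(ℝ, E) (𝓘(ℝ, E).prod 𝓘(ℝ, E)) ∞
      (fun x => (TotalSpace.mk' E x (coordField x₀ u x) : TangentBundle 𝓘(ℝ, E) M))
      (chartAt E x₀).source := by
  let e := trivializationAt E (TangentSpace 𝓘(ℝ, E) : M → Type _) x₀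
  refine (e.contMDiffOn_section_baseSet_iff (IB := 𝓘(ℝ, E)) (n := ∞)).2 ?_
  refine (contMDiffOn_const (c := u)).congr fun x hx => ?_
  have coordField_eq : coordField x₀ u x = e.symmL ℝ x u := by
    have h := DFunLike.congr_fun
      (TangentBundle.symmL_trivializationAt (I := 𝓘(ℝ, E)) (x₀ := x₀) hx) u
    rw [ModelWithCorners.range_eq_univ, mfderivWithin_univ] at h
    exact h.symm
  have h := e.continuousLinearMapAt_symmL (R := ℝ) hx u
  rw [Trivialization.continuousLinearMapAt_apply, Trivialization.linearMapAt_apply, if_pos hx] at h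
  rw [coordField_eq, h]

theorem EndField.IsSmooth.contMDiffOn_apply {φ : EndField E M} (hφ : φ.IsSmooth) {X : VField E M}
    {s : Set M} (hX : ContMDiffOn 𝓘(ℝ, E) (𝓘(ℝ, E).prod 𝓘(ℝ, E)) ∞
      (fun x => (TotalSpace.mk' E x (X x) : TangentBundle 𝓘(ℝ, E) M)) s) :
    ContMDiffOn 𝓘(ℝ, E) (𝓘(ℝ, E).prod 𝓘(ℝ, E)) ∞
      (fun x => (TotalSpace.mk' E x (φ x (X x)) : TangentBundle 𝓘(ℝ, E) M)) s :=
  ContMDiffOn.clm_bundle_apply (b := fun x : M => x) (ContMDiff.contMDiffOn hφ) hX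

theorem EndField.IsSmooth.contDiffOn_chart [FiniteDimensional ℝ E] {φ : EndField E M}
    (hφ : φ.IsSmooth) (x₀ : M) :
    ContDiffOn ℝ ∞ (φ.chart x₀) (extChartAt 𝓘(ℝ, E) x₀).target := by
  refine contDiffOn_clm_apply.2 fun u => ?_
  refine (VField.contDiffOn_chart (hφ.contMDiffOn_apply
    (contMDiffOn_coordField x₀ u))).congr fun y hy => ?_
  rw [VField.chart, coordField_symm hy]
  rfl

theorem contDiffOn_chartMetric [FiniteDimensional ℝ E] (g : RMetric E M) (x₀ : M) :
    ContDiffOn ℝ ∞ (chartMetric g x₀) (extChartAt 𝓘(ℝ, E) x₀).target := by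
  refine contDiffOn_clm_apply.2 fun u => contDiffOn_clm_apply.2 fun v => ?_
  have smooth_section := ContMDiffOn.clm_bundle_apply₂ (b := fun x : M => x)
    (E₃ := Bundle.Trivial M ℝ) (F₃ := ℝ) (IM := 𝓘(ℝ, E)) (IB := 𝓘(ℝ, E)) (n := ∞) (ψ := g.inner)
    (ContMDiff.contMDiffOn g.contMDiff) (contMDiffOn_coordField x₀ u) (contMDiffOn_coordField x₀ v)
  have smooth_inner : ContMDiffOn 𝓘(ℝ, E) 𝓘(ℝ, ℝ) ∞
      (fun x => g.inner x (coordField x₀ u x) (coordField x₀ v x)) (chartAt E x₀).source :=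
    fun x hx => (contMDiffWithinAt_totalSpace.1 (smooth_section x hx)).2
  have smooth_comp := smooth_inner.comp (contMDiffOn_extChartAt_symm (n := ∞) x₀)
    (mapsTo_extChartAt_symm x₀)
  refine (contMDiffOn_iff_contDiffOn.1 smooth_comp).congr fun y hy => ?_
  rw [Function.comp_apply, coordField_symm hy, coordField_symm hy]
  rfl

theorem VField.IsSmooth.differentiableAt_chart {X : VField E M} (hX : X.IsSmooth) (x₀ : M) :
    DifferentiableAt ℝ (X.chart x₀) (extChartAt 𝓘(ℝ, E) x₀ x₀) :=
  ((VField.contDiffOn_chart (ContMDiff.contMDiffOn hX)).contDiffAt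
    (extChartAt_target_mem_nhds x₀)).differentiableAt (by simp)

theorem EndField.IsSmooth.differentiableAt_chart [FiniteDimensional ℝ E] {φ : EndField E M}
    (hφ : φ.IsSmooth) (x₀ : M) :
    DifferentiableAt ℝ (φ.chart x₀) (extChartAt 𝓘(ℝ, E) x₀ x₀) :=
  ((hφ.contDiffOn_chart x₀).contDiffAt (extChartAt_target_mem_nhds x₀)).differentiableAt (by simp)

theorem differentiableAt_chartMetric [FiniteDimensional ℝ E] (g : RMetric E M) (x₀ : M) :
    DifferentiableAt ℝ (chartMetric g x₀) (extChartAt 𝓘(ℝ, E) x₀ x₀) :=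
  ((contDiffOn_chartMetric g x₀).contDiffAt (extChartAt_target_mem_nhds x₀)).differentiableAt
    (by simp)

theorem VField.exists_isSmooth_eq [FiniteDimensional ℝ E] [T2Space M] (x₀ : M) (u : E) :
    ∃ X : VField E M, X.IsSmooth ∧ X x₀ = u := by
  let f : SmoothBumpFunction 𝓘(ℝ, E) x₀ := Nonempty.some inferInstance
  refine ⟨fun x => f x • coordField x₀ u x, ?_, ?_⟩
  · exact ContMDiffOn.smul_section_of_tsupport f.contMDiff.contMDiffOn
      (chartAt E x₀).open_source f.tsupport_subset_chartAt_source (contMDiffOn_coordField x₀ u)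
  · simp only [f.eq_one, coordField, chartD_self]
    exact one_smul ℝ u

theorem mlieBracket_eq_lieBracket_chart (X Y : VField E M) (x₀ : M) :
    mlieBracket 𝓘(ℝ, E) X Y x₀ =
      lieBracket ℝ (X.chart x₀) (Y.chart x₀) (extChartAt 𝓘(ℝ, E) x₀ x₀) := by
  let pullback : VField E M → E → E := fun X =>
    mpullbackWithin 𝓘(ℝ, E) 𝓘(ℝ, E) (extChartAt 𝓘(ℝ, E) x₀).symm X (range 𝓘(ℝ, E))
  have pullback_eq : ∀ X, pullback X =ᶠ[𝓝 (extChartAt 𝓘(ℝ, E) x₀ x₀)] X.chart x₀ := fun X => by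
    filter_upwards [extChartAt_target_mem_nhds x₀] with y hy
    simp only [pullback]
    rw [mpullbackWithin_apply, ContinuousLinearMap.inverse_eq
      (mfderivWithin_extChartAt_symm_comp_mfderiv_extChartAt hy)
      (mfderiv_extChartAt_comp_mfderivWithin_extChartAt_symm hy)]
    rfl
  let L : E →L[ℝ] E := mfderiv 𝓘(ℝ, E) 𝓘(ℝ, E) (extChartAt 𝓘(ℝ, E) x₀) x₀
  have hL : L = ContinuousLinearMap.id ℝ E := mfderiv_extChartAt_self (I := 𝓘(ℝ, E)) (x := x₀)
  change L.inverse (lieBracketWithin ℝ (pullback X) (pullback Y)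
    ((extChartAt 𝓘(ℝ, E) x₀).symm ⁻¹' univ ∩ range 𝓘(ℝ, E)) (extChartAt 𝓘(ℝ, E) x₀ x₀)) = _
  rw [hL, preimage_univ, univ_inter, ModelWithCorners.range_eq_univ, lieBracketWithin_univ,
    (pullback_eq X).lieBracket_vectorField_eq (pullback_eq Y), ContinuousLinearMap.inverse_id]
  rfl

theorem DForm.d_eq_extDeriv_inChart {k : ℕ} (θ : DForm E M k) (x₀ : M) (v : Fin (k + 1) → E) :
    θ.d x₀ v = extDeriv (θ.inChart x₀) (extChartAt 𝓘(ℝ, E) x₀ x₀) v := by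
  rw [DForm.d, mfderiv_extChartAt_self]
  rfl

end Chart

section Connection

variable {E : Type*} [NormedAddCommGroup E] [NormedSpace ℝ E]

section Definitions

variable (Γ : E →L[ℝ] E →L[ℝ] E)

/-- The bilinear map `Γ` consists of the Christoffel symbols at `y₀` of the Levi-Civita connection
of the metric `G` on the vector space `E`. -/
structure IsChristoffel (G : E → E →L[ℝ] E →L[ℝ] ℝ) (y₀ : E) : Prop where
  symm : ∀ u v, Γ u v = Γ v u
  metric : ∀ u v w, fderiv ℝ G y₀ u v w = G y₀ (Γ u v) w + G y₀ v (Γ u w)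

/-- The covariant derivative `u ↦ ∇_u Z` at `y₀` of a vector field, with Christoffel symbols `Γ`. -/
def covDerivVec (Z : E → E) (y₀ : E) : E →L[ℝ] E := fderiv ℝ Z y₀ + Γ.flip (Z y₀)

/-- The covariant derivative `u ↦ ∇_u F` at `y₀` of a field of endomorphisms, with Christoffel
symbols `Γ`. -/
def covDerivEnd (F : E → E →L[ℝ] E) (y₀ : E) : E →L[ℝ] E →L[ℝ] E :=
  fderiv ℝ F y₀ + (ContinuousLinearMap.compL ℝ E E E).flip (F y₀) ∘L Γ
    - ContinuousLinearMap.compL ℝ E E E (F y₀) ∘L Γ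

end Definitions

variable {Γ : E →L[ℝ] E →L[ℝ] E} {G : E → E →L[ℝ] E →L[ℝ] ℝ} {F : E → E →L[ℝ] E} {X Y Z : E → E}
  {y₀ : E}

theorem exists_rightInverse_of_pos [FiniteDimensional ℝ E] {g : E →L[ℝ] E →L[ℝ] ℝ}
    (pos : ∀ v, v ≠ 0 → 0 < g v v) : ∃ sharp : (E →L[ℝ] ℝ) →L[ℝ] E, ∀ f, g (sharp f) = f := by
  have injective : Function.Injective g := (injective_iff_map_eq_zero g).2 fun v hv => by
    by_contra hne
    simpa [hv] using pos v hne
  have finrank_dual : Module.finrank ℝ E = Module.finrank ℝ (E →L[ℝ] ℝ) := by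
    rw [← (LinearMap.toContinuousLinearMap (𝕜 := ℝ) (E := E) (F' := ℝ)).finrank_eq]
    exact Subspace.dual_finrank_eq.symm
  let e := LinearMap.linearEquivOfInjective g.toLinearMap injective finrank_dual
  exact ⟨e.symm.toLinearMap.toContinuousLinearMap, e.apply_symm_apply⟩

set_option maxSynthPendingDepth 4 in
theorem exists_isChristoffel [FiniteDimensional ℝ E] (hG : DifferentiableAt ℝ G y₀)
    (symm : ∀ᶠ y in 𝓝 y₀, ∀ u v, G y u v = G y v u) (pos : ∀ v, v ≠ 0 → 0 < G y₀ v v) :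
    ∃ Γ : E →L[ℝ] E →L[ℝ] E, IsChristoffel Γ G y₀ := by
  obtain ⟨sharp, g_sharp⟩ := exists_rightInverse_of_pos pos
  let G' := fderiv ℝ G y₀
  have symm_deriv : ∀ u v w, G' u v w = G' u w v := fun u v w => by
    have eval : ∀ v w, fderiv ℝ (fun y => G y v w) y₀ u = G' u v w := fun v w => by
      simp [fderiv_clm_apply (hG.clm_apply (differentiableAt_const v)) (differentiableAt_const w),
        fderiv_clm_apply hG (differentiableAt_const v), G']
    rw [← eval, ← eval, Filter.EventuallyEq.fderiv_eq (symm.mono fun y hy => hy v w)]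
  -- Koszul's formula for constant vector fields, whose brackets vanish.
  let flipLast : (E →L[ℝ] E →L[ℝ] ℝ) →L[ℝ] E →L[ℝ] E →L[ℝ] ℝ :=
    (ContinuousLinearMap.flipₗᵢ ℝ E E ℝ).toContinuousLinearEquiv
  let koszul : E →L[ℝ] E →L[ℝ] E →L[ℝ] ℝ :=
    (1 / 2 : ℝ) • (G' + G'.flip - flipLast ∘L G'.flip)
  let Γ := ContinuousLinearMap.compL ℝ E (E →L[ℝ] ℝ) E sharp ∘L koszul
  have inner_Γ : ∀ u v w, G y₀ (Γ u v) w = 1 / 2 * (G' u v w + G' v u w - G' w u v) :=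
    fun u v w => DFunLike.congr_fun (g_sharp (koszul u v)) w
  refine ⟨Γ, fun u v => ?_, fun u v w => ?_⟩
  · have koszul_symm : koszul u v = koszul v u := by
      ext w
      change 1 / 2 * (G' u v w + G' v u w - G' w u v) = 1 / 2 * (G' v u w + G' u v w - G' w v u)
      rw [symm_deriv w u v]
      ring
    exact congrArg sharp koszul_symm
  · rw [symm.self_of_nhds v, inner_Γ, inner_Γ, symm_deriv u w v, symm_deriv v u w,
      symm_deriv w u v]
    ring

theorem covDerivVec_apply (u : E) : covDerivVec Γ Z y₀ u = fderiv ℝ Z y₀ u + Γ u (Z y₀) := rfl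

theorem covDerivEnd_apply (u v : E) :
    covDerivEnd Γ F y₀ u v = fderiv ℝ F y₀ u v + Γ u (F y₀ v) - F y₀ (Γ u v) := rfl

theorem covDerivVec_const (u v : E) : covDerivVec Γ (fun _ => v) y₀ u = Γ u v := by
  simp [covDerivVec_apply]

theorem covDerivVec_congr (h : X =ᶠ[𝓝 y₀] Y) : covDerivVec Γ X y₀ = covDerivVec Γ Y y₀ := by
  rw [covDerivVec, covDerivVec, h.fderiv_eq, h.eq_of_nhds]

theorem covDerivVec_sum {ι : Type*} [Fintype ι] {Z : ι → E → E}
    (hZ : ∀ i, DifferentiableAt ℝ (Z i) y₀) (c : ι → ℝ) :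
    covDerivVec Γ (fun y => ∑ i, c i • Z i y) y₀ = ∑ i, c i • covDerivVec Γ (Z i) y₀ := by
  rw [covDerivVec, fderiv_fun_sum (A := fun i y => c i • Z i y)
    fun i _ => (hZ i).const_smul (c i)]
  simp [covDerivVec, fderiv_fun_const_smul (hZ _), Finset.sum_add_distrib]

theorem covDerivEnd_sum {ι : Type*} [Fintype ι] {F : ι → E → E →L[ℝ] E}
    (hF : ∀ i, DifferentiableAt ℝ (F i) y₀) (c : ι → ℝ) :
    covDerivEnd Γ (fun y => ∑ i, c i • F i y) y₀ = ∑ i, c i • covDerivEnd Γ (F i) y₀ := by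
  ext u v
  rw [covDerivEnd_apply, fderiv_fun_sum (A := fun i y => c i • F i y)
    fun i _ => (hF i).const_smul (c i)]
  simp [covDerivEnd_apply, fderiv_fun_const_smul (hF _), Finset.sum_add_distrib, smul_add, smul_sub]

theorem covDerivVec_map (hF : DifferentiableAt ℝ F y₀) (hZ : DifferentiableAt ℝ Z y₀) (u : E) :
    covDerivVec Γ (fun y => F y (Z y)) y₀ u =
      covDerivEnd Γ F y₀ u (Z y₀) + F y₀ (covDerivVec Γ Z y₀ u) := by
  simp only [covDerivVec_apply, covDerivEnd_apply, fderiv_clm_apply hF hZ, add_apply, map_add,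
    ContinuousLinearMap.comp_apply, ContinuousLinearMap.flip_apply]
  abel

theorem covDerivVec_smul {f : E → ℝ} (hf : DifferentiableAt ℝ f y₀) (hZ : DifferentiableAt ℝ Z y₀)
    (u : E) :
    covDerivVec Γ (fun y => f y • Z y) y₀ u =
      f y₀ • covDerivVec Γ Z y₀ u + fderiv ℝ f y₀ u • Z y₀ := by
  simp only [covDerivVec_apply, fderiv_fun_smul hf hZ, add_apply, map_smul, smul_add,
    smul_apply, ContinuousLinearMap.smulRight_apply]
  abel

theorem covDerivVec_add (hX : DifferentiableAt ℝ X y₀) (hY : DifferentiableAt ℝ Y y₀) :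
    covDerivVec Γ (fun y => X y + Y y) y₀ = covDerivVec Γ X y₀ + covDerivVec Γ Y y₀ := by
  ext u
  simp only [covDerivVec_apply, fderiv_fun_add hX hY, add_apply, map_add]
  abel

namespace IsChristoffel

variable (hΓ : IsChristoffel Γ G y₀)
include hΓ

theorem lieBracket_eq : lieBracket ℝ X Y y₀ =
    covDerivVec Γ Y y₀ (X y₀) - covDerivVec Γ X y₀ (Y y₀) := by
  rw [VectorField.lieBracket_eq, covDerivVec_apply, covDerivVec_apply, hΓ.symm]
  module

theorem nijenhuis_eq (hF : DifferentiableAt ℝ F y₀) (hX : DifferentiableAt ℝ X y₀)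
    (hY : DifferentiableAt ℝ Y y₀) :
    lieBracket ℝ (fun y => F y (X y)) (fun y => F y (Y y)) y₀
        - F y₀ (lieBracket ℝ (fun y => F y (X y)) Y y₀)
        - F y₀ (lieBracket ℝ X (fun y => F y (Y y)) y₀)
        + F y₀ (F y₀ (lieBracket ℝ X Y y₀)) =
      covDerivEnd Γ F y₀ (F y₀ (X y₀)) (Y y₀) - covDerivEnd Γ F y₀ (F y₀ (Y y₀)) (X y₀)
        + F y₀ (covDerivEnd Γ F y₀ (Y y₀) (X y₀)) - F y₀ (covDerivEnd Γ F y₀ (X y₀) (Y y₀)) := by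
  simp only [hΓ.lieBracket_eq, covDerivVec_map hF hX, covDerivVec_map hF hY, map_sub, map_add]
  abel

theorem fderiv_inner (hG : DifferentiableAt ℝ G y₀) (hX : DifferentiableAt ℝ X y₀)
    (hY : DifferentiableAt ℝ Y y₀) (u : E) :
    fderiv ℝ (fun y => G y (X y) (Y y)) y₀ u =
      G y₀ (covDerivVec Γ X y₀ u) (Y y₀) + G y₀ (X y₀) (covDerivVec Γ Y y₀ u) := by
  simp only [fderiv_clm_apply (hG.clm_apply hX) hY, fderiv_clm_apply hG hX, add_apply,
    ContinuousLinearMap.comp_apply, ContinuousLinearMap.flip_apply, hΓ.metric, covDerivVec_apply,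
    map_add]
  ring

theorem extDeriv_oneForm (hG : DifferentiableAt ℝ G y₀) (hZ : DifferentiableAt ℝ Z y₀)
    {θ : E → E [⋀^Fin 1]→L[ℝ] ℝ} (hθ : DifferentiableAt ℝ θ y₀)
    (h : ∀ᶠ y in 𝓝 y₀, ∀ v, θ y v = G y (Z y) (v 0)) (u v : E) :
    extDeriv θ y₀ ![u, v] =
      G y₀ (covDerivVec Γ Z y₀ u) v - G y₀ (covDerivVec Γ Z y₀ v) u := by
  have eval : ∀ w, (fun y => θ y w) =ᶠ[𝓝 y₀] fun y => G y (Z y) (w 0) :=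
    fun w => h.mono fun y hy => hy w
  rw [extDeriv_apply hθ, Fin.sum_univ_two, (eval _).fderiv_eq, (eval _).fderiv_eq,
    hΓ.fderiv_inner hG hZ (differentiableAt_const _),
    hΓ.fderiv_inner hG hZ (differentiableAt_const _), covDerivVec_const, covDerivVec_const]
  simp only [Fin.removeNth, Fin.succAbove, Fin.coe_ofNat_eq_mod, Nat.zero_mod, Nat.mod_succ,
    pow_zero, pow_one, Fin.castSucc_zero, lt_self_iff_false, zero_lt_one, ↓reduceIte,
    Fin.succ_zero_eq_one, Matrix.cons_val_zero, Matrix.cons_val_one, Matrix.cons_val_fin_one,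
    hΓ.symm v u, one_smul, neg_smul]
  ring

theorem extDeriv_twoForm (hG : DifferentiableAt ℝ G y₀) (hF : DifferentiableAt ℝ F y₀)
    {θ : E → E [⋀^Fin 2]→L[ℝ] ℝ} (hθ : DifferentiableAt ℝ θ y₀)
    (h : ∀ᶠ y in 𝓝 y₀, ∀ v, θ y v = G y (v 0) (F y (v 1))) (u v w : E) :
    extDeriv θ y₀ ![u, v, w] = G y₀ v (covDerivEnd Γ F y₀ u w) - G y₀ u (covDerivEnd Γ F y₀ v w)
      + G y₀ u (covDerivEnd Γ F y₀ w v) := by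
  have eval : ∀ w, (fun y => θ y w) =ᶠ[𝓝 y₀] fun y => G y (w 0) (F y (w 1)) :=
    fun w => h.mono fun y hy => hy w
  have skew : G y₀ v (F y₀ (Γ u w)) = -G y₀ (Γ u w) (F y₀ v) := by
    have swap : θ y₀ ![v, Γ u w] = -θ y₀ ![Γ u w, v] := by
      rw [show ![v, Γ u w] = ![Γ u w, v] ∘ Equiv.swap 0 1 by ext i; fin_cases i <;> rfl]
      exact (θ y₀).toAlternatingMap.map_swap _ Fin.zero_ne_one
    rwa [h.self_of_nhds, h.self_of_nhds] at swap
  have deriv_eval : ∀ a b c, fderiv ℝ (fun y => G y b (F y c)) y₀ a =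
      G y₀ (Γ a b) (F y₀ c) + G y₀ b (covDerivEnd Γ F y₀ a c) + G y₀ b (F y₀ (Γ a c)) := by
    intro a b c
    rw [hΓ.fderiv_inner hG (differentiableAt_const _) (hF.clm_apply (differentiableAt_const _)),
      covDerivVec_map hF (differentiableAt_const _), covDerivVec_const, covDerivVec_const, map_add]
    ring
  rw [extDeriv_apply hθ, Fin.sum_univ_three, (eval _).fderiv_eq, (eval _).fderiv_eq,
    (eval _).fderiv_eq, deriv_eval, deriv_eval, deriv_eval]
  simp only [Fin.removeNth, Fin.succAbove, Fin.coe_ofNat_eq_mod, Nat.zero_mod, Nat.one_mod,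
    Nat.mod_succ, pow_zero, pow_one, even_two, Even.neg_pow, one_pow, Fin.castSucc_zero,
    Fin.castSucc_one, lt_self_iff_false, zero_lt_one, not_lt_zero, Fin.reduceLT, ↓reduceIte,
    Fin.succ_zero_eq_one, Fin.succ_one_eq_two, Matrix.cons_val, hΓ.symm v u, hΓ.symm w u,
    hΓ.symm w v, skew, one_smul, neg_smul]
  ring

section ContactMetric

variable (hG : DifferentiableAt ℝ G y₀) (hF : DifferentiableAt ℝ F y₀)
  (hZ : DifferentiableAt ℝ Z y₀) (h : ∀ᶠ y in 𝓝 y₀, IsLinearContactMetric (G y) (F y) (Z y))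
include hG hF hZ h

theorem covDerivEnd_sq (u v : E) :
    covDerivEnd Γ F y₀ u (F y₀ v) + F y₀ (covDerivEnd Γ F y₀ u v) =
      G y₀ (covDerivVec Γ Z y₀ u) v • Z y₀ + G y₀ (Z y₀) v • covDerivVec Γ Z y₀ u := by
  have hv := differentiableAt_const (𝕜 := ℝ) (x := y₀) v
  have hFv := hF.clm_apply hv
  have hZv := (hG.clm_apply hZ).clm_apply hv
  have key := DFunLike.congr_fun (covDerivVec_congr (Γ := Γ)
    (X := fun y => F y (F y v) + v) (Y := fun y => G y (Z y) v • Z y)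
    (h.mono fun y hy => by simp [hy.sq])) u
  simp only [covDerivVec_add (hF.clm_apply hFv) hv, add_apply, covDerivVec_map hF hFv,
    covDerivVec_map hF hv, covDerivVec_smul hZv hZ, covDerivVec_const,
    hΓ.fderiv_inner hG hZ hv, map_add, h.self_of_nhds.sq] at key
  linear_combination (norm := module) (1 : ℝ) • key

omit hZ in
theorem inner_covDerivEnd_skew (u v w : E) :
    G y₀ (covDerivEnd Γ F y₀ u v) w = -G y₀ v (covDerivEnd Γ F y₀ u w) := by
  have hv := differentiableAt_const (𝕜 := ℝ) (x := y₀) v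
  have hw := differentiableAt_const (𝕜 := ℝ) (x := y₀) w
  have skew : (fun y => G y (F y v) w) =ᶠ[𝓝 y₀] fun y => -G y v (F y w) :=
    h.mono fun y hy => hy.skew v w
  have key := DFunLike.congr_fun (skew.fderiv_eq (𝕜 := ℝ)) u
  simp only [fderiv_fun_neg, neg_apply, hΓ.fderiv_inner hG (hF.clm_apply hv) hw,
    hΓ.fderiv_inner hG hv (hF.clm_apply hw), covDerivVec_map hF hv, covDerivVec_map hF hw,
    covDerivVec_const, map_add, add_apply, h.self_of_nhds.skew] at key
  linarith

omit hΓ hG in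
theorem covDerivEnd_map_ξ (u : E) :
    covDerivEnd Γ F y₀ u (Z y₀) = -F y₀ (covDerivVec Γ Z y₀ u) := by
  have key := DFunLike.congr_fun (covDerivVec_congr (Γ := Γ)
    (X := fun y => F y (Z y)) (Y := fun _ => 0) (h.mono fun y hy => hy.map_ξ)) u
  simp only [covDerivVec_map hF hZ, covDerivVec_const, map_zero] at key
  exact eq_neg_of_add_eq_zero_left key

omit hF in
theorem inner_covDerivVec_ξ (u : E) : G y₀ (Z y₀) (covDerivVec Γ Z y₀ u) = 0 := by
  have unit : (fun y => G y (Z y) (Z y)) =ᶠ[𝓝 y₀] fun _ => 1 := h.mono fun y hy => hy.unit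
  have key := DFunLike.congr_fun (unit.fderiv_eq (𝕜 := ℝ)) u
  simp only [hΓ.fderiv_inner hG hZ hZ, fderiv_fun_const, Pi.zero_apply, zero_apply,
    h.self_of_nhds.symm (covDerivVec Γ Z y₀ u)] at key
  linarith

theorem isQuasiSasakianJet
    (normal : ∀ u v, covDerivEnd Γ F y₀ (F y₀ u) v - covDerivEnd Γ F y₀ (F y₀ v) u
      + F y₀ (covDerivEnd Γ F y₀ v u) - F y₀ (covDerivEnd Γ F y₀ u v)
      + (G y₀ (covDerivVec Γ Z y₀ u) v - G y₀ (covDerivVec Γ Z y₀ v) u) • Z y₀ = 0)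
    (closed : ∀ u v w, G y₀ v (covDerivEnd Γ F y₀ u w) - G y₀ u (covDerivEnd Γ F y₀ v w)
      + G y₀ u (covDerivEnd Γ F y₀ w v) = 0) :
    IsQuasiSasakianJet (G y₀) (F y₀) (Z y₀) (covDerivEnd Γ F y₀) (covDerivVec Γ Z y₀) where
  toIsLinearContactMetric := h.self_of_nhds
  deriv_sq := hΓ.covDerivEnd_sq hG hF hZ h
  deriv_skew := hΓ.inner_covDerivEnd_skew hG hF h
  deriv_map_ξ := covDerivEnd_map_ξ hF hZ h
  deriv_unit := hΓ.inner_covDerivVec_ξ hG hZ h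
  normal := normal
  closed := closed

end ContactMetric

end IsChristoffel

end Connection

section Forms

variable {E E' : Type*} [NormedAddCommGroup E] [NormedSpace ℝ E] [FiniteDimensional ℝ E]
  [NormedAddCommGroup E'] [NormedSpace ℝ E']

theorem contDiffOn_continuousAlternatingMap_apply {k : ℕ} {n : WithTop ℕ∞}
    {f : E' → E [⋀^Fin k]→L[ℝ] ℝ} {s : Set E'} (hf : ∀ v, ContDiffOn ℝ n (fun y => f y v) s) :
    ContDiffOn ℝ n f s := by
  let b := Module.finBasis ℝ E
  let eval : E [⋀^Fin k]→L[ℝ] ℝ →ₗ[ℝ] (Fin k → Fin (Module.finrank ℝ E)) → ℝ :=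
    LinearMap.pi fun i => ⟨⟨fun θ => θ (b ∘ i), fun _ _ => rfl⟩, fun _ _ => rfl⟩
  have eval_injective : LinearMap.ker eval = ⊥ := LinearMap.ker_eq_bot'.2 fun θ hθ =>
    ContinuousAlternatingMap.toAlternatingMap_injective
      (b.ext_alternating fun i _ => congrFun hθ i)
  obtain ⟨recover, h⟩ := eval.exists_leftInverse_of_injective eval_injective
  have smooth_eval : ContDiffOn ℝ n (fun y => eval (f y)) s :=
    contDiffOn_pi.2 fun i => hf (b ∘ i)
  refine (recover.toContinuousLinearMap.contDiff.comp_contDiffOn smooth_eval).congr fun y _ => ?_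
  exact (LinearMap.congr_fun h (f y)).symm

end Forms

section LeviCivita

variable {E : Type*} [NormedAddCommGroup E] [NormedSpace ℝ E] [FiniteDimensional ℝ E]
  {M : Type*} [TopologicalSpace M] [ChartedSpace E M] [IsManifold 𝓘(ℝ, E) ∞ M]

theorem exists_isChristoffel_chartMetric (g : RMetric E M) (x : M) :
    ∃ Γ, IsChristoffel Γ (chartMetric g x) (extChartAt 𝓘(ℝ, E) x x) := by
  refine exists_isChristoffel (differentiableAt_chartMetric g x)
    (Filter.Eventually.of_forall fun y u v => ?_) fun v hv => ?_
  · rw [chartMetric_apply, chartMetric_apply]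
    exact g.symm _ _ _
  · rw [chartMetric_self]
    exact g.pos x v hv

/-- The Christoffel symbols at `x` of the Levi-Civita connection, in the preferred chart at `x`. -/
def christoffel (g : RMetric E M) (x : M) : E →L[ℝ] E →L[ℝ] E :=
  Classical.choose (exists_isChristoffel_chartMetric g x)

theorem isChristoffel_christoffel (g : RMetric E M) (x : M) :
    IsChristoffel (christoffel g x) (chartMetric g x) (extChartAt 𝓘(ℝ, E) x x) :=
  Classical.choose_spec (exists_isChristoffel_chartMetric g x)

/-- The Levi-Civita covariant derivative `u ↦ ∇_u X` of a vector field at `x`. -/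
def VField.covDeriv (X : VField E M) (g : RMetric E M) (x : M) :
    TangentSpace 𝓘(ℝ, E) x →L[ℝ] TangentSpace 𝓘(ℝ, E) x :=
  covDerivVec (E := E) (christoffel g x) (X.chart x) (extChartAt 𝓘(ℝ, E) x x)

/-- The Levi-Civita covariant derivative `u ↦ ∇_u φ` of a field of endomorphisms at `x`. -/
def EndField.covDeriv (φ : EndField E M) (g : RMetric E M) (x : M) :
    TangentSpace 𝓘(ℝ, E) x →L[ℝ] TangentSpace 𝓘(ℝ, E) x →L[ℝ] TangentSpace 𝓘(ℝ, E) x :=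
  covDerivEnd (E := E) (christoffel g x) (φ.chart x) (extChartAt 𝓘(ℝ, E) x x)

variable {φ : EndField E M} {X Y : VField E M} (g : RMetric E M)

theorem VField.covDeriv_map (hφ : φ.IsSmooth) (hX : X.IsSmooth) (x : M)
    (u : TangentSpace 𝓘(ℝ, E) x) :
    VField.covDeriv (fun y => φ y (X y)) g x u =
      φ.covDeriv g x u (X x) + φ x (X.covDeriv g x u) := by
  have key := covDerivVec_map (Γ := christoffel g x) (hφ.differentiableAt_chart x)
    (hX.differentiableAt_chart x) u
  rw [VField.chart_self, EndField.chart_self,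
    ← covDerivVec_congr (VField.chart_map_eventuallyEq φ X x)] at key
  exact key

theorem nijenhuis_eq_covDeriv (hφ : φ.IsSmooth) (hX : X.IsSmooth) (hY : Y.IsSmooth) (x : M) :
    mlieBracket 𝓘(ℝ, E) (fun y => φ y (X y)) (fun y => φ y (Y y)) x
        - φ x (mlieBracket 𝓘(ℝ, E) (fun y => φ y (X y)) Y x)
        - φ x (mlieBracket 𝓘(ℝ, E) X (fun y => φ y (Y y)) x)
        + φ x (φ x (mlieBracket 𝓘(ℝ, E) X Y x)) =
      φ.covDeriv g x (φ x (X x)) (Y x) - φ.covDeriv g x (φ x (Y x)) (X x)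
        + φ x (φ.covDeriv g x (Y x) (X x)) - φ x (φ.covDeriv g x (X x) (Y x)) := by
  have key := (isChristoffel_christoffel g x).nijenhuis_eq (hφ.differentiableAt_chart x)
    (hX.differentiableAt_chart x) (hY.differentiableAt_chart x)
  have mapX := VField.chart_map_eventuallyEq φ X x
  have mapY := VField.chart_map_eventuallyEq φ Y x
  rw [← mapX.lieBracket_vectorField_eq mapY,
    ← mapX.lieBracket_vectorField_eq (Filter.EventuallyEq.refl _ (Y.chart x)),
    ← (Filter.EventuallyEq.refl _ (X.chart x)).lieBracket_vectorField_eq mapY] at key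
  simp only [← mlieBracket_eq_lieBracket_chart, EndField.chart_self, VField.chart_self] at key
  exact key

end LeviCivita

section ContactMetric

variable {E : Type*} [NormedAddCommGroup E] [NormedSpace ℝ E]
  {M : Type*} [TopologicalSpace M] [ChartedSpace E M] [IsManifold 𝓘(ℝ, E) ∞ M]
  {φ : EndField E M} {ξ : VField E M} {η : OneForm E M} {g : RMetric E M} {x₀ : M} {y : E}

theorem OneForm.toDForm_inChart_apply (hη : ∀ x v, η x v = g.inner x (ξ x) v)
    (hy : y ∈ (extChartAt 𝓘(ℝ, E) x₀).target) (v : Fin 1 → E) :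
    η.toDForm.inChart x₀ y v = chartMetric g x₀ y (ξ.chart x₀ y) (v 0) := by
  rw [chartMetric_apply, chartD_chart_vField ξ hy]
  exact hη _ _

theorem OneForm.isSmooth_toDForm [FiniteDimensional ℝ E] (hξ : ξ.IsSmooth)
    (hη : ∀ x v, η x v = g.inner x (ξ x) v) : η.toDForm.IsSmooth := fun x₀ =>
  contDiffOn_continuousAlternatingMap_apply fun v =>
    ((contDiffOn_chartMetric g x₀).clm_apply (VField.contDiffOn_chart (ContMDiff.contMDiffOn hξ))
      |>.clm_apply contDiffOn_const).congr fun _ hy => toDForm_inChart_apply hη hy v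

theorem OneForm.toDForm_d_apply [FiniteDimensional ℝ E] (hξ : ξ.IsSmooth)
    (hη : ∀ x v, η x v = g.inner x (ξ x) v) (x : M) (u v : TangentSpace 𝓘(ℝ, E) x) :
    η.toDForm.d x ![u, v] =
      g.inner x (ξ.covDeriv g x u) v - g.inner x (ξ.covDeriv g x v) u := by
  have key := (isChristoffel_christoffel g x).extDeriv_oneForm (differentiableAt_chartMetric g x)
    (hξ.differentiableAt_chart x) ((isSmooth_toDForm hξ hη).differentiableAt_inChart x)
    (Filter.eventually_of_mem (extChartAt_target_mem_nhds x) fun _ hy =>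
      toDForm_inChart_apply hη hy) u v
  rw [chartMetric_self, ← DForm.d_eq_extDeriv_inChart] at key
  exact key

namespace IsAlmostContactMetric

variable (h : IsAlmostContactMetric φ ξ η g)
include h

theorem skew (x : M) (u v : TangentSpace 𝓘(ℝ, E) x) :
    g.inner x (φ x u) v = -g.inner x u (φ x v) := by
  have polarized := h.inner_φ_self x (u + v)
  simp only [map_add, add_apply, h.inner_φ_self] at polarized
  rw [g.symm x (φ x u)]
  linarith

theorem map_ξ (x : M) : φ x (ξ x) = 0 := by
  by_contra hne
  refine (g.pos x _ hne).ne' ?_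
  have key := h.skew x (φ x (ξ x)) (ξ x)
  rw [h.φ_sq, h.η_ξ, one_smul, neg_add_cancel, map_zero, zero_apply] at key
  linarith

theorem η_eq (x : M) (v : TangentSpace 𝓘(ℝ, E) x) : η x v = g.inner x (ξ x) v := by
  have key := h.compatible x v (ξ x)
  rw [h.map_ξ, map_zero, h.η_ξ, mul_one] at key
  rw [g.symm]
  linarith

theorem isLinearContactMetric (x : M) :
    IsLinearContactMetric (g.inner x) (φ x) (ξ x) where
  symm := g.symm x
  pos := g.pos x
  sq v := by rw [h.φ_sq, h.η_eq]
  map_ξ := h.map_ξ x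
  skew := h.skew x
  unit := (h.η_eq x (ξ x)).symm.trans (h.η_ξ x)

theorem isLinearContactMetric_chart (hy : y ∈ (extChartAt 𝓘(ℝ, E) x₀).target) :
    IsLinearContactMetric (chartMetric g x₀ y) (φ.chart x₀ y) (ξ.chart x₀ y) := by
  have hx := h.isLinearContactMetric ((extChartAt 𝓘(ℝ, E) x₀).symm y)
  have injective := chartD_injective hy
  refine ⟨fun u v => ?symm, fun v hv => ?pos, fun v => injective ?sq, injective ?map_ξ,
    fun u v => ?skew, ?unit⟩
  case symm =>
    rw [chartMetric_apply, chartMetric_apply]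
    exact hx.symm _ _
  case pos =>
    rw [chartMetric_apply]
    exact hx.pos _ ((map_ne_zero_iff _ injective).2 hv)
  case sq =>
    rw [chartD_chart_endField φ hy, chartD_chart_endField φ hy, map_add, map_neg, map_smul,
      chartMetric_apply, chartD_chart_vField ξ hy]
    exact hx.sq _
  case map_ξ =>
    rw [chartD_chart_endField φ hy, chartD_chart_vField ξ hy, map_zero]
    exact hx.map_ξ
  case skew =>
    rw [chartMetric_apply, chartMetric_apply, chartD_chart_endField φ hy,
      chartD_chart_endField φ hy]
    exact hx.skew _ _
  case unit =>
    rw [chartMetric_apply, chartD_chart_vField ξ hy]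
    exact hx.unit

theorem fundamentalForm_inChart_apply (hy : y ∈ (extChartAt 𝓘(ℝ, E) x₀).target)
    (v : Fin 2 → E) :
    h.fundamentalForm.inChart x₀ y v = chartMetric g x₀ y (v 0) (φ.chart x₀ y (v 1)) := by
  rw [chartMetric_apply, chartD_chart_endField φ hy]
  rfl

variable [FiniteDimensional ℝ E]

theorem fundamentalForm_isSmooth : h.fundamentalForm.IsSmooth := fun x₀ =>
  contDiffOn_continuousAlternatingMap_apply fun v =>
    ((contDiffOn_chartMetric g x₀).clm_apply contDiffOn_const
      |>.clm_apply ((h.smooth_φ.contDiffOn_chart x₀).clm_apply contDiffOn_const)).congr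
        fun _ hy => h.fundamentalForm_inChart_apply hy v

theorem fundamentalForm_d_apply (x : M) (u v w : TangentSpace 𝓘(ℝ, E) x) :
    h.fundamentalForm.d x ![u, v, w] = g.inner x v (φ.covDeriv g x u w)
      - g.inner x u (φ.covDeriv g x v w) + g.inner x u (φ.covDeriv g x w v) := by
  have key := (isChristoffel_christoffel g x).extDeriv_twoForm (differentiableAt_chartMetric g x)
    (h.smooth_φ.differentiableAt_chart x) (h.fundamentalForm_isSmooth.differentiableAt_inChart x)
    (Filter.eventually_of_mem (extChartAt_target_mem_nhds x) fun _ hy =>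
      h.fundamentalForm_inChart_apply hy) u v w
  rw [chartMetric_self, ← DForm.d_eq_extDeriv_inChart] at key
  exact key

theorem isNormal_iff [T2Space M] : IsNormal φ ξ η ↔
    ∀ (x : M) (u v : TangentSpace 𝓘(ℝ, E) x),
      φ.covDeriv g x (φ x u) v - φ.covDeriv g x (φ x v) u + φ x (φ.covDeriv g x v u)
        - φ x (φ.covDeriv g x u v)
        + (g.inner x (ξ.covDeriv g x u) v - g.inner x (ξ.covDeriv g x v) u) • ξ x = 0 := by
  simp only [← OneForm.toDForm_d_apply h.smooth_ξ h.η_eq]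
  refine ⟨fun normal x u v => ?_, fun H X Y hX hY x => ?_⟩
  · obtain ⟨X, hX, rfl⟩ := VField.exists_isSmooth_eq (E := E) x u
    obtain ⟨Y, hY, rfl⟩ := VField.exists_isSmooth_eq (E := E) x v
    rw [← nijenhuis_eq_covDeriv g h.smooth_φ hX hY]
    exact normal X Y hX hY x
  · rw [nijenhuis_eq_covDeriv g h.smooth_φ hX hY]
    exact H x (X x) (Y x)

theorem isClosed_fundamentalForm_iff : h.fundamentalForm.IsClosed ↔
    ∀ (x : M) (u v w : TangentSpace 𝓘(ℝ, E) x), g.inner x v (φ.covDeriv g x u w)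
      - g.inner x u (φ.covDeriv g x v w) + g.inner x u (φ.covDeriv g x w v) = 0 := by
  simp only [← h.fundamentalForm_d_apply]
  refine ⟨fun closed x u v w => by rw [closed x]; rfl, fun H x => ?_⟩
  ext v
  rw [show v = ![v 0, v 1, v 2] by ext i; fin_cases i <;> rfl]
  exact H x _ _ _

end IsAlmostContactMetric

theorem IsQuasiSasakian.jet [FiniteDimensional ℝ E] [T2Space M] (h : IsQuasiSasakian φ ξ η g)
    (x : M) :
    IsQuasiSasakianJet (g.inner x) (φ x) (ξ x) (φ.covDeriv g x) (ξ.covDeriv g x) := by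
  have key := (isChristoffel_christoffel g x).isQuasiSasakianJet (differentiableAt_chartMetric g x)
    (h.smooth_φ.differentiableAt_chart x) (h.smooth_ξ.differentiableAt_chart x)
    (Filter.eventually_of_mem (extChartAt_target_mem_nhds x)
      fun _ hy => h.isLinearContactMetric_chart hy)
  simp only [chartMetric_self, EndField.chart_self, VField.chart_self] at key
  exact key (h.isNormal_iff.1 h.normal x) (h.isClosed_fundamentalForm_iff.1 h.closed x)

section StructureOperator

variable [FiniteDimensional ℝ E]

theorem IsAlmostContactMetric.isQuasiSasakian [T2Space M] (h : IsAlmostContactMetric φ ξ η g)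
    (hA : ∀ x, ∃ A, IsStructureOperator (g.inner x) (φ x) (ξ x) (φ.covDeriv g x)
      (ξ.covDeriv g x) A) : IsQuasiSasakian φ ξ η g where
  toIsAlmostContactMetric := h
  normal := h.isNormal_iff.2 fun x => (hA x).choose_spec.normal (h.isLinearContactMetric x)
  closed := h.isClosed_fundamentalForm_iff.2 fun x => (hA x).choose_spec.closed (g.symm x)

theorem IsStructureOperator.mem_charDist_iff (h : IsAlmostContactMetric φ ξ η g) {x : M}
    {A : TangentSpace 𝓘(ℝ, E) x →L[ℝ] TangentSpace 𝓘(ℝ, E) x}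
    (hA : IsStructureOperator (g.inner x) (φ x) (ξ x) (φ.covDeriv g x) (ξ.covDeriv g x) A)
    (v : TangentSpace 𝓘(ℝ, E) x) : v ∈ charDist η x ↔ g.inner x (ξ x) v = 0 ∧ A v = 0 := by
  refine Iff.trans ?_ (hA.charSpace_iff (h.isLinearContactMetric x) v)
  simp only [← h.η_eq, ← OneForm.toDForm_d_apply h.smooth_ξ h.η_eq]
  rfl

end StructureOperator

end ContactMetric

section Combinations

variable {E : Type*} [NormedAddCommGroup E] [NormedSpace ℝ E]
  {M : Type*} [TopologicalSpace M] [ChartedSpace E M] [IsManifold 𝓘(ℝ, E) ∞ M]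
  {N : ℕ} (lam : EuclideanSpace ℝ (Fin N))

theorem VField.isSmooth_combo {ξ : Fin N → VField E M} (hξ : ∀ α, (ξ α).IsSmooth) :
    VField.IsSmooth (combo lam ξ) :=
  ContMDiff.sum_section fun α _ => (hξ α).const_smul_section (a := lam α)

theorem EndField.isSmooth_combo {φ : Fin N → EndField E M} (hφ : ∀ α, (φ α).IsSmooth) :
    EndField.IsSmooth (combo lam φ) :=
  ContMDiff.sum_section fun α _ => (hφ α).const_smul_section (a := lam α)

omit [IsManifold 𝓘(ℝ, E) ∞ M] in
theorem VField.chart_combo (ξ : Fin N → VField E M) (x₀ : M) :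
    VField.chart (combo lam ξ) x₀ = fun y => ∑ α, lam α • (ξ α).chart x₀ y := by
  funext y
  exact (map_sum (chartDInv x₀ y) _ _).trans
    (Finset.sum_congr rfl fun α _ => map_smul (chartDInv x₀ y) _ _)

omit [IsManifold 𝓘(ℝ, E) ∞ M] in
theorem EndField.chart_combo (φ : Fin N → EndField E M) (x₀ : M) :
    EndField.chart (combo lam φ) x₀ = fun y => ∑ α, lam α • (φ α).chart x₀ y := by
  funext y
  ext v
  rw [_root_.sum_apply]
  change chartDInv x₀ y ((show E →L[ℝ] E from
    ∑ α, lam α • (show E →L[ℝ] E from φ α ((extChartAt 𝓘(ℝ, E) x₀).symm y))) (chartD x₀ y v)) = _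
  rw [_root_.sum_apply, map_sum]
  refine Finset.sum_congr rfl fun α _ => ?_
  rw [smul_apply, map_smul]
  rfl

theorem OneForm.combo_eq_inner {g : RMetric E M} {ξ : Fin N → VField E M} {η : Fin N → OneForm E M}
    (hη : ∀ α x v, η α x v = g.inner x (ξ α x) v) (x : M) (v : TangentSpace 𝓘(ℝ, E) x) :
    combo lam η x v = g.inner x (combo lam ξ x) v := by
  simp only [combo, map_sum, _root_.sum_apply, map_smul, smul_apply, hη]

variable [FiniteDimensional ℝ E]

theorem VField.covDeriv_combo (g : RMetric E M) {ξ : Fin N → VField E M}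
    (hξ : ∀ α, (ξ α).IsSmooth) (x : M) :
    VField.covDeriv (combo lam ξ) g x = ∑ α, lam α • (ξ α).covDeriv g x := by
  rw [VField.covDeriv, VField.chart_combo]
  exact covDerivVec_sum (fun α => (hξ α).differentiableAt_chart x) lam

theorem EndField.covDeriv_combo (g : RMetric E M) {φ : Fin N → EndField E M}
    (hφ : ∀ α, (φ α).IsSmooth) (x : M) :
    EndField.covDeriv (combo lam φ) g x = ∑ α, lam α • (φ α).covDeriv g x := by
  rw [EndField.covDeriv, EndField.chart_combo]
  exact covDerivEnd_sum (fun α => (hφ α).differentiableAt_chart x) lam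

end Combinations

theorem sum_sq_of_mem_sphere {ι : Type*} [Fintype ι] {lam : EuclideanSpace ℝ ι}
    (hlam : lam ∈ Metric.sphere 0 1) : ∑ i, lam i ^ 2 = 1 := by
  rw [← EuclideanSpace.real_norm_sq_eq, mem_sphere_zero_iff_norm.1 hlam, one_pow]

instance {E : Type*} [NormedAddCommGroup E] [NormedSpace ℝ E] [FiniteDimensional ℝ E]
    {M : Type*} [TopologicalSpace M] [ChartedSpace E M] (x : M) :
    FiniteDimensional ℝ (TangentSpace 𝓘(ℝ, E) x) :=
  inferInstanceAs (FiniteDimensional ℝ E)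

section ThreeStructure

variable {E : Type*} [NormedAddCommGroup E] [NormedSpace ℝ E]
  {M : Type*} [TopologicalSpace M] [ChartedSpace E M] [IsManifold 𝓘(ℝ, E) ∞ M]
  {φ : Fin 3 → EndField E M} {ξ : Fin 3 → VField E M} {η : Fin 3 → OneForm E M} {g : RMetric E M}
  {lam : EuclideanSpace ℝ (Fin 3)}

namespace IsThreeQuasiSasakian

variable (h : IsThreeQuasiSasakian φ ξ η g)
include h

theorem isLinearThreeStructure (x : M) :
    IsLinearThreeStructure (g.inner x) (fun α => φ α x) (fun α => ξ α x) where
  contactMetric α := (h.quasiSasakian α).isLinearContactMetric x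
  φ_left α v := by rw [h.φ_left, (h.quasiSasakian _).η_eq]
  φ_right α v := by rw [h.φ_right, (h.quasiSasakian _).η_eq]
  ξ_left α := h.ξ_left α x
  ξ_right α := h.ξ_right α x

theorem fundamentalForm_combo
    (hc : IsAlmostContactMetric (combo lam φ) (combo lam ξ) (combo lam η) g) :
    hc.fundamentalForm = combo lam h.Ω := by
  funext x
  ext v
  refine Eq.trans ?_ (ContinuousAlternatingMap.sum_apply _ _).symm
  change g.inner x (v 0) ((∑ α, lam α • φ α x) (v 1)) =
    ∑ α, lam α * g.inner x (v 0) (φ α x (v 1))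
  simp only [_root_.sum_apply, map_sum, smul_apply, map_smul, smul_eq_mul]

variable [FiniteDimensional ℝ E]

theorem exists_finrank_eq [Nonempty M] : ∃ n, Module.finrank ℝ E = 2 * n + 1 := by
  obtain ⟨m, hm⟩ := (h.isLinearThreeStructure (Classical.arbitrary M)).exists_finrank_eq
  exact ⟨2 * m + 1, hm.trans (by ring)⟩

theorem isAlmostContactMetric_combo (hlam : ∑ α, lam α ^ 2 = 1) :
    IsAlmostContactMetric (combo lam φ) (combo lam ξ) (combo lam η) g := by
  have hη : ∀ x v, combo lam η x v = g.inner x (combo lam ξ x) v :=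
    OneForm.combo_eq_inner lam fun α => (h.quasiSasakian α).η_eq
  have smooth_ξ := VField.isSmooth_combo lam fun α => (h.quasiSasakian α).smooth_ξ
  have linear : ∀ x, IsLinearContactMetric (g.inner x) (combo lam φ x) (combo lam ξ x) :=
    fun x => (h.isLinearThreeStructure x).combo hlam
  exact {
    smooth_φ := EndField.isSmooth_combo lam fun α => (h.quasiSasakian α).smooth_φ
    smooth_ξ := smooth_ξ
    smooth_η := OneForm.isSmooth_toDForm smooth_ξ hη
    φ_sq := fun x v => by rw [hη, (linear x).sq]
    η_ξ := fun x => by rw [hη, (linear x).unit]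
    compatible := fun x v w => by rw [hη, hη, (linear x).inner_map_map] }

variable [T2Space M]

theorem jet (x : M) : IsThreeQuasiSasakianJet (g.inner x) (fun α => φ α x) (fun α => ξ α x)
    (fun α => (φ α).covDeriv g x) (fun α => (ξ α).covDeriv g x) where
  toIsLinearThreeStructure := h.isLinearThreeStructure x
  jet α := (h.quasiSasakian α).jet x
  deriv_ξ_left α u := by
    rw [← VField.covDeriv_map g (h.quasiSasakian α).smooth_φ (h.quasiSasakian (α + 1)).smooth_ξ,
      ← funext (h.ξ_left α)]

theorem exists_isStructureOperator (x : M) : ∃ A, ∀ α,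
    IsStructureOperator (g.inner x) (φ α x) (ξ α x) ((φ α).covDeriv g x) ((ξ α).covDeriv g x) A :=
  (h.jet x).exists_isStructureOperator

omit [T2Space M] in
theorem isStructureOperator_combo (lam : EuclideanSpace ℝ (Fin 3)) {x : M}
    {A : TangentSpace 𝓘(ℝ, E) x →L[ℝ] TangentSpace 𝓘(ℝ, E) x}
    (hA : ∀ α, IsStructureOperator (g.inner x) (φ α x) (ξ α x) ((φ α).covDeriv g x)
      ((ξ α).covDeriv g x) A) :
    IsStructureOperator (g.inner x) (combo lam φ x) (combo lam ξ x)
      (EndField.covDeriv (combo lam φ) g x) (VField.covDeriv (combo lam ξ) g x) A := by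
  rw [EndField.covDeriv_combo lam g fun α => (h.quasiSasakian α).smooth_φ,
    VField.covDeriv_combo lam g fun α => (h.quasiSasakian α).smooth_ξ]
  exact IsStructureOperator.combo hA lam

theorem isQuasiSasakian_combo (hlam : ∑ α, lam α ^ 2 = 1) :
    IsQuasiSasakian (combo lam φ) (combo lam ξ) (combo lam η) g :=
  (h.isAlmostContactMetric_combo hlam).isQuasiSasakian fun x =>
    (h.exists_isStructureOperator x).imp fun _ hA => h.isStructureOperator_combo lam hA

end IsThreeQuasiSasakian

end ThreeStructure

section Rank

variable {E : Type*} [NormedAddCommGroup E] [NormedSpace ℝ E] [FiniteDimensional ℝ E]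
  {M : Type*} [TopologicalSpace M] [ChartedSpace E M] [IsManifold 𝓘(ℝ, E) ∞ M]

theorem IsAlmostContactMetric.isAlmostCosymplectic {φ : EndField E M} {ξ : VField E M}
    {η : OneForm E M} {g : RMetric E M} (h : IsAlmostContactMetric φ ξ η g)
    (hn : ∃ n, Module.finrank ℝ E = 2 * n + 1) : IsAlmostCosymplectic η h.fundamentalForm := by
  obtain ⟨n, hn⟩ := hn
  exact ⟨h.smooth_η, h.fundamentalForm_isSmooth, n, hn, fun x =>
    (h.isLinearContactMetric x).wedge_ne_zero hn (h.η_eq x) (h.fundamentalForm_apply x)⟩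

namespace IsThreeQuasiSasakianOfRank

variable [T2Space M] {φ : Fin 3 → EndField E M} {ξ : Fin 3 → VField E M}
  {η : Fin 3 → OneForm E M} {g : RMetric E M} {l : ℕ} {lam : EuclideanSpace ℝ (Fin 3)}
  (h : IsThreeQuasiSasakianOfRank φ ξ η g (4 * l + 3))
include h

theorem exists_forall_mem_charDist_iff (x : M) :
    ∃ A : TangentSpace 𝓘(ℝ, E) x →L[ℝ] TangentSpace 𝓘(ℝ, E) x,
      (∀ α v, v ∈ charDist (η α) x ↔ A v = 0) ∧
        ∀ lam : EuclideanSpace ℝ (Fin 3), ∑ α, lam α ^ 2 = 1 →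
          ∀ v, v ∈ charDist (combo lam η) x ↔ A v = 0 := by
  obtain ⟨A, hA⟩ := h.exists_isStructureOperator x
  have linear := h.isLinearThreeStructure x
  obtain ⟨a, ha⟩ := linear.exists_eigenvalue fun α => (hA α).comm
  have ha0 : a ≠ 0 := linear.eigenvalue_ne_zero (hA 0).symm (fun α => (hA α).comm) ha (α := 0)
    ((hA 0).mem_charDist_iff (h.quasiSasakian 0).toIsAlmostContactMetric) (h.rank 0 x)
  refine ⟨A, fun α v => ?_, fun lam hlam v => ?_⟩
  · rw [(hA α).mem_charDist_iff (h.quasiSasakian α).toIsAlmostContactMetric]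
    exact and_iff_right_of_imp (inner_eq_zero_of_map_eq_zero (hA α).symm (ha α) ha0)
  · have map_combo : A (combo lam ξ x) = a • combo lam ξ x := by
      simp only [combo, map_sum, map_smul, ha, Finset.smul_sum, smul_comm a]
    rw [(h.isStructureOperator_combo lam hA).mem_charDist_iff (h.isAlmostContactMetric_combo hlam)]
    exact and_iff_right_of_imp (inner_eq_zero_of_map_eq_zero (hA 0).symm map_combo ha0)

theorem charDist_combo_eq_commonCharDist (hlam : ∑ α, lam α ^ 2 = 1) (x : M) :
    charDist (combo lam η) x = commonCharDist η x := by
  obtain ⟨A, hA, hA_combo⟩ := h.exists_forall_mem_charDist_iff x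
  ext v
  simp only [commonCharDist, Submodule.mem_iInf, hA, hA_combo lam hlam, forall_const]

theorem hasRank_combo (hlam : ∑ α, lam α ^ 2 = 1) : HasRank (combo lam η) (4 * l + 3) := by
  intro x
  obtain ⟨A, hA, hA_combo⟩ := h.exists_forall_mem_charDist_iff x
  have charDist_eq : charDist (combo lam η) x = charDist (η 0) x :=
    Submodule.ext fun v => (hA_combo lam hlam v).trans (hA 0 v).symm
  rw [cartanClass, charDist_eq]
  exact h.rank 0 x

end IsThreeQuasiSasakianOfRank

end Rank

end QuasiContact

end

theorem mainTheorem7 {E : Type*} [NormedAddCommGroup E] [NormedSpace ℝ E] [FiniteDimensional ℝ E]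
    {M : Type*} [TopologicalSpace M] [T2Space M] [SecondCountableTopology M] [Nonempty M]
    [ChartedSpace E M] [IsManifold 𝓘(ℝ, E) ∞ M]
    (φ : Fin 3 → QuasiContact.EndField E M) (ξ : Fin 3 → QuasiContact.VField E M)
    (η : Fin 3 → QuasiContact.OneForm E M) (g : QuasiContact.RMetric E M) (l : ℕ)
    (h : QuasiContact.IsThreeQuasiSasakianOfRank φ ξ η g (4 * l + 3)) :
    (∀ lam ∈ Metric.sphere (0 : EuclideanSpace ℝ (Fin 3)) 1,
      QuasiContact.IsQuasiSasakian (QuasiContact.combo lam φ) (QuasiContact.combo lam ξ)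
          (QuasiContact.combo lam η) g ∧
        QuasiContact.HasRank (QuasiContact.combo lam η) (4 * l + 3) ∧
        ∀ x : M, QuasiContact.charDist (QuasiContact.combo lam η) x =
          QuasiContact.commonCharDist η x) ∧
    QuasiContact.IsQuasiContactSphere (p := 2) η h.Ω (4 * l + 3) := by
  have sum_sq {lam : EuclideanSpace ℝ (Fin 3)} (hlam : lam ∈ Metric.sphere 0 1) :
      ∑ α, lam α ^ 2 = 1 := QuasiContact.sum_sq_of_mem_sphere hlam
  have dim := h.exists_finrank_eq
  refine ⟨fun lam hlam => ⟨h.isQuasiSasakian_combo (sum_sq hlam), h.hasRank_combo (sum_sq hlam),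
    h.charDist_combo_eq_commonCharDist (sum_sq hlam)⟩,
    ⟨fun α => ?generators, fun lam hlam => ?combos⟩,
    fun lam hlam => ?closed, by omega, fun lam hlam => h.hasRank_combo (sum_sq hlam)⟩
  case generators => exact (h.quasiSasakian α).isAlmostCosymplectic dim
  case combos =>
    have contactMetric := h.isAlmostContactMetric_combo (sum_sq hlam)
    rw [← h.fundamentalForm_combo contactMetric]
    exact contactMetric.isAlmostCosymplectic dim
  case closed =>
    have quasiSasakian := h.isQuasiSasakian_combo (sum_sq hlam)
    rw [← h.fundamentalForm_combo quasiSasakian.toIsAlmostContactMetric]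
    exact quasiSasakian.closed
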